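/- Let $\mathfrak A$ be a (not necessarily unital) $C^*$-algebra and let $H,K,E$ be Hilbert $\mathfrak A$-modules. Write $\mathcal L(H,K)$ for the space of adjointable operators from $H$ to $K$ with the operator norm, $\mathcal L(H)=\mathcal L(H,H)$, and $\mathcal R(T)$ for the range of $T$. The Moore–Penrose (M-P) inverse of $T\in\mathcal L(H,K)$, if it exists, is the unique $T^\dagger\in\mathcal L(K,H)$ with $TT^\dagger T=T$, $T^\dagger TT^\dagger=T^\dagger$, $(TT^\dagger)^*=TT^\dagger$ and $(T^\dagger T)^*=T^\dagger T$; then $T$ is called M-P invertible. An element of $\mathcal L(K)$ is positive definite if it is self-adjoint, invertible in $\mathcal L(K)$ and a positive element of the $C^*$-algebra $\mathcal L(K)$. A pair $(M,N)$ of submodules of $H$ is separated if $M\cap N=\{0\}$ and $M+N$ is closed in $H$. **Theorem.** Let $A\in\mathcal L(H,K)$ and $B\in\mathcal L(H,E)$ be such that $A$ and $A^*A+B^*B$ are both M-P invertible, and let $V\in\mathcal L(K)$ and $W\in\mathcal L(E)$ be positive definite. Then there is a unique decomposition $B=B_1+B_2$ with $B_1,B_2\in\mathcal L(H,E)$ such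 that $$B_2^*WB_1=0,\qquad \mathcal R(B_1^*)\subseteq\mathcal R(A^*),\qquad \big(\mathcal R(A^*),\mathcal R(B_2^*)\big)\ \text{is a separated pair}.$$ For this decomposition and for every positive definite $W'\in\mathcal L(E)$, the operators $A^*VA+tB^*WB$ $(t>0)$, $A^*VA+B_2^*W'B_2$, $A^*VA$ and $B_2$ are M-P invertible, $2I_H-A^\dagger A-B_2^\dagger B_2$ is invertible in $\mathcal L(H)$, and, in the operator-norm topology, $$\lim_{t\to0^+}\left(A^*VA+tB^*WB\right)^\dagger A^*V=\left(A^*VA+B_2^*W'B_2\right)^\dagger A^*V=(A^*VA)^\dagger A^*V-(I_H-A^\dagger A)\,\Pi',$$ where $$\Pi'=\left(2I_H-A^\dagger A-B_2^\dagger B_2\right)^{-1}(A^*VA)^\dagger A^*V .$$ -/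

import Mathlib

open Filter Topology

noncomputable section HilbertModuleOperators

section Adjointable

variable (𝔄 : Type*) [NonUnitalCStarAlgebra 𝔄] [PartialOrder 𝔄] [StarOrderedRing 𝔄]
  (H : Type*) [NormedAddCommGroup H] [NormedSpace ℂ H] [SMul 𝔄 H] [CStarModule 𝔄 H]
  (K : Type*) [NormedAddCommGroup K] [NormedSpace ℂ K] [SMul 𝔄 K] [CStarModule 𝔄 K]

/-- The adjointable operators from `H` to `K`, inside the bounded operators (hence carrying the
operator norm). Asking for boundedness of `T` and of its adjoint is no restriction, see
`exists_mem_adjointable_of_inner_eq`. -/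
def adjointable : Submodule ℂ (H →L[ℂ] K) where
  carrier := {T | ∃ S : K →L[ℂ] H, ∀ x y, inner 𝔄 (T x) y = inner 𝔄 x (S y)}
  add_mem' := by
    rintro T₁ T₂ ⟨S₁, h₁⟩ ⟨S₂, h₂⟩
    exact ⟨S₁ + S₂, fun x y => by simp [h₁, h₂]⟩
  zero_mem' := ⟨0, fun x y => by simp⟩
  smul_mem' := by
    rintro c T ⟨S, h⟩
    exact ⟨star c • S, fun x y => by simp [h]⟩

/-- The space `𝓛(H, K)` of adjointable operators between Hilbert `𝔄`-modules, with the
operator norm. -/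
abbrev AdjOp : Type _ := adjointable 𝔄 H K

end Adjointable

variable {𝔄 : Type*} [NonUnitalCStarAlgebra 𝔄] [PartialOrder 𝔄] [StarOrderedRing 𝔄]
  {H : Type*} [NormedAddCommGroup H] [NormedSpace ℂ H] [SMul 𝔄 H] [CStarModule 𝔄 H]
  {K : Type*} [NormedAddCommGroup K] [NormedSpace ℂ K] [SMul 𝔄 K] [CStarModule 𝔄 K]
  {E : Type*} [NormedAddCommGroup E] [NormedSpace ℂ E] [SMul 𝔄 E] [CStarModule 𝔄 E]

theorem eq_of_forall_inner_eq {a b : H} (h : ∀ x : H, inner 𝔄 x a = inner 𝔄 x b) : a = b := by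
  rw [← sub_eq_zero, ← CStarModule.inner_self (A := 𝔄)]
  simp [CStarModule.inner_sub_right, h]

/-- Any map between Hilbert `𝔄`-modules that has an adjoint map is an element of `𝓛(H, K)`:
linearity and boundedness are automatic. -/
theorem exists_mem_adjointable_of_inner_eq [CompleteSpace H] [CompleteSpace K]
    (T : H → K) (S : K → H) (h : ∀ x y, inner 𝔄 (T x) y = inner 𝔄 x (S y)) :
    ∃ T' ∈ adjointable 𝔄 H K, ∀ x, T' x = T x := by
  have h' : ∀ x y, inner 𝔄 y (T x) = inner 𝔄 (S y) x := fun x y => by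
    rw [← CStarModule.star_inner (T x) y, h, CStarModule.star_inner]
  let T₀ : H →ₗ[ℂ] K :=
    { toFun := T
      map_add' := fun a b => eq_of_forall_inner_eq (𝔄 := 𝔄) fun y => by simp [h']
      map_smul' := fun c a => eq_of_forall_inner_eq (𝔄 := 𝔄) fun y => by simp [h'] }
  let S₀ : K →ₗ[ℂ] H :=
    { toFun := S
      map_add' := fun a b => eq_of_forall_inner_eq (𝔄 := 𝔄) fun y => by simp [← h]
      map_smul' := fun c a => eq_of_forall_inner_eq (𝔄 := 𝔄) fun y => by simp [← h] }
  have hT : Continuous T₀ := by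
    refine T₀.continuous_of_seq_closed_graph fun u x y hu hTu =>
      eq_of_forall_inner_eq (𝔄 := 𝔄) fun z => ?_
    have h1 := ((CStarModule.innerSL (A := 𝔄) z).continuous.tendsto y).comp hTu
    have h2 := ((CStarModule.innerSL (A := 𝔄) (S z)).continuous.tendsto x).comp hu
    refine (tendsto_nhds_unique h1 (h2.congr fun n => ?_)).trans (h' x z).symm
    exact (h' (u n) z).symm
  have hS : Continuous S₀ := by
    refine S₀.continuous_of_seq_closed_graph fun u x y hu hTu =>
      eq_of_forall_inner_eq (𝔄 := 𝔄) fun z => ?_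
    have h1 := ((CStarModule.innerSL (A := 𝔄) z).continuous.tendsto y).comp hTu
    have h2 := ((CStarModule.innerSL (A := 𝔄) (T z)).continuous.tendsto x).comp hu
    refine (tendsto_nhds_unique h1 (h2.congr fun n => ?_)).trans (h z x)
    exact h z (u n)
  exact ⟨⟨T₀, hT⟩, ⟨⟨S₀, hS⟩, h⟩, fun _ => rfl⟩

namespace AdjOp

/-- The adjoint `T*` of an adjointable operator. -/
def adj (T : AdjOp 𝔄 H K) : AdjOp 𝔄 K H :=
  ⟨T.2.choose, T.1, fun x y => by
    rw [← CStarModule.star_inner, ← T.2.choose_spec, CStarModule.star_inner]⟩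

/-- The defining property of `T*` (which determines it, by `eq_of_forall_inner_eq`). -/
theorem inner_adj (T : AdjOp 𝔄 H K) (x : H) (y : K) :
    inner 𝔄 (T.1 x) y = inner 𝔄 x (T.adj.1 y) :=
  T.2.choose_spec x y

/-- The composition (product) `T S` of adjointable operators. -/
def comp (T : AdjOp 𝔄 K E) (S : AdjOp 𝔄 H K) : AdjOp 𝔄 H E :=
  ⟨T.1.comp S.1, S.adj.1.comp T.adj.1, fun x y => by simp [inner_adj]⟩

variable (𝔄 H) in
/-- The identity operator `I_H`. -/
def idOp : AdjOp 𝔄 H H := ⟨ContinuousLinearMap.id ℂ H, ContinuousLinearMap.id ℂ H, by simp⟩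

/-- The range of `T`. -/
def ran (T : AdjOp 𝔄 H K) : Submodule ℂ K := LinearMap.range (T.1 : H →ₗ[ℂ] K)

end AdjOp

/-- Product of adjointable operators. -/
infixr:75 " ⬝ " => AdjOp.comp

/-- `X` is a two-sided inverse of `T` in `𝓛(H)`. -/
def AdjOp.IsInverse (T X : AdjOp 𝔄 H H) : Prop :=
  X ⬝ T = AdjOp.idOp 𝔄 H ∧ T ⬝ X = AdjOp.idOp 𝔄 H

/-- `T` is invertible in `𝓛(H)`. -/
def AdjOp.Invertible (T : AdjOp 𝔄 H H) : Prop := ∃ X, T.IsInverse X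

open Classical in
/-- The inverse `T⁻¹` in `𝓛(H)`; the value is `0` when `T` is not invertible. -/
def AdjOp.inverse (T : AdjOp 𝔄 H H) : AdjOp 𝔄 H H :=
  if h : T.Invertible then h.choose else 0

/-- `M` is positive definite: self-adjoint, invertible in `𝓛(H)`, and a positive element of the
C⋆-algebra `𝓛(H)`, that is, of the form `S* S` with `S ∈ 𝓛(H)`. -/
structure AdjOp.PosDefinite (M : AdjOp 𝔄 H H) : Prop where
  selfAdjoint : M.adj = M
  invertible : M.Invertible
  positive : ∃ S : AdjOp 𝔄 H H, M = S.adj ⬝ S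

/-- `X` is a Moore–Penrose inverse of `T`: the four Penrose equations. -/
structure AdjOp.IsMPInverse (T : AdjOp 𝔄 H K) (X : AdjOp 𝔄 K H) : Prop where
  mul_mul_self : T ⬝ X ⬝ T = T
  self_mul_mul : X ⬝ T ⬝ X = X
  adj_left : (T ⬝ X).adj = T ⬝ X
  adj_right : (X ⬝ T).adj = X ⬝ T

/-- `T` has a Moore–Penrose inverse. -/
def AdjOp.MPInvertible (T : AdjOp 𝔄 H K) : Prop := ∃ X, T.IsMPInverse X

open Classical in
/-- The Moore–Penrose inverse `T†`; the value is `0` when `T` is not M-P invertible. -/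
def AdjOp.mpInv (T : AdjOp 𝔄 H K) : AdjOp 𝔄 K H :=
  if h : T.MPInvertible then h.choose else 0

/-- `(M, N)` is a separated pair of submodules: `M ∩ N = {0}` and `M + N` is closed. -/
def IsSeparatedPair (M N : Submodule ℂ H) : Prop :=
  M ⊓ N = ⊥ ∧ IsClosed ((M ⊔ N : Submodule ℂ H) : Set H)

/-- `B = B₁ + B₂` with `B₂* W B₁ = 0`, `R(B₁*) ⊆ R(A*)` and `(R(A*), R(B₂*))` separated. -/
structure IsSeparatedDecomposition (A : AdjOp 𝔄 H K) (B : AdjOp 𝔄 H E) (W : AdjOp 𝔄 E E)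
    (B₁ B₂ : AdjOp 𝔄 H E) : Prop where
  eq_add : B = B₁ + B₂
  orthogonal : B₂.adj ⬝ W ⬝ B₁ = 0
  range_le : B₁.adj.ran ≤ A.adj.ran
  separated : IsSeparatedPair A.adj.ran B₂.adj.ran

end HilbertModuleOperators

/-!
Let `P = A†A` be the projection onto `R(A*)`, let `R` be the projection onto its complement in
`R(A*A + B*B)`, and let `G` be the inverse of `B*WB` compressed to the corner of `R`. Block
elimination of `B*WB` along `R` produces the idempotent `F = G B*WB` with range `R`, and the
decomposition is `B₁ = B - B F`, `B₂ = B F`: the separation condition forces `B₂` to vanish on the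
kernel of `F`.

Suppose that `m` is invertible in the corner of `P`, with inverse `x`. Conjugation by the unipotent
`1 + F P` turns `m + B₂*W'B₂` into a block diagonal operator whose `P` block is `m`, whatever `W'`
is, so that `(m + B₂*W'B₂)†A* = (1 - F) x A*`. For `m = A*VA + t B₁*WB₁` and `W' = t W` the left
side is `(A*VA + t B*WB)†A*`, and the right side is continuous at `t = 0` because inversion in the
corner of `P` is. For `m = A*VA` this is the value of the limit, and `F` is expressed through
`B₂†B₂` by `F P = (1 - P) (2 - P - B₂†B₂)⁻¹ P`.
-/

noncomputable section HilbertModuleLimits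

section CornerInverse

/-- `x` is an inverse of `m` in the corner `p S p` cut out by the idempotent `p`. -/
structure IsCornerInverse {S : Type*} [Mul S] (p m x : S) : Prop where
  mul_inv : m * x = p
  inv_mul : x * m = p
  proj_mul : p * m = m
  proj_mul_inv : p * x = x

namespace IsCornerInverse

section Semigroup

variable {S : Type*} [Semigroup S] {p m x y : S}

theorem mul_proj (h : IsCornerInverse p m x) : m * p = m := by
  rw [← h.inv_mul, ← mul_assoc, h.mul_inv, h.proj_mul]

theorem inv_mul_proj (h : IsCornerInverse p m x) : x * p = x := by
  rw [← h.mul_inv, ← mul_assoc, h.inv_mul, h.proj_mul_inv]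

theorem isIdempotentElem (h : IsCornerInverse p m x) : IsIdempotentElem p := by
  rw [IsIdempotentElem]
  nth_rw 2 [← h.mul_inv]
  rw [← mul_assoc, h.proj_mul, h.mul_inv]

theorem unique (hx : IsCornerInverse p m x) (hy : IsCornerInverse p m y) : x = y := by
  rw [← hx.inv_mul_proj, ← hy.mul_inv, ← mul_assoc, hx.inv_mul, hy.proj_mul_inv]

protected theorem star [StarMul S] (h : IsCornerInverse p m x) :
    IsCornerInverse (star p) (star m) (star x) where
  mul_inv := by rw [← star_mul, h.inv_mul]
  inv_mul := by rw [← star_mul, h.mul_inv]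
  proj_mul := by rw [← star_mul, h.mul_proj]
  proj_mul_inv := by rw [← star_mul, h.inv_mul_proj]

theorem isSelfAdjoint [StarMul S] (h : IsCornerInverse p m x) (hp : IsSelfAdjoint p)
    (hm : IsSelfAdjoint m) : IsSelfAdjoint x := by
  have hstar := h.star
  rw [hp.star_eq, hm.star_eq] at hstar
  exact hstar.unique h

end Semigroup

theorem units_conj {S : Type*} [Monoid S] {p m x : S} (h : IsCornerInverse p m x) {u v : Sˣ}
    (hu : Commute p u) (hv : Commute p v) :
    IsCornerInverse p (v * m * u) (↑u⁻¹ * x * ↑v⁻¹) where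
  mul_inv := by
    calc (v * m * u * (↑u⁻¹ * x * ↑v⁻¹) : S) = v * (m * x) * ↑v⁻¹ := by simp [mul_assoc]
      _ = p := by rw [h.mul_inv, ← hv.eq, Units.mul_inv_cancel_right]
  inv_mul := by
    calc (↑u⁻¹ * x * ↑v⁻¹ * (v * m * u) : S) = ↑u⁻¹ * ((x * m) * u) := by simp [mul_assoc]
      _ = p := by rw [h.inv_mul, hu.eq, Units.inv_mul_cancel_left]
  proj_mul := by rw [← mul_assoc, ← mul_assoc, hv.eq, mul_assoc (v : S), h.proj_mul]
  proj_mul_inv := by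
    rw [← mul_assoc, ← mul_assoc, hu.units_inv_right.eq, mul_assoc (↑u⁻¹ : S), h.proj_mul_inv]

protected theorem add {S : Type*} [NonUnitalRing S] {p q m n x y : S} (hp : IsCornerInverse p m x)
    (hq : IsCornerInverse q n y) (hpq : p * q = 0) (hqp : q * p = 0) :
    IsCornerInverse (p + q) (m + n) (x + y) where
  mul_inv := by
    have hmy : m * y = 0 := by
      rw [← hp.mul_proj, ← hq.proj_mul_inv, mul_assoc, ← mul_assoc p, hpq, zero_mul, mul_zero]
    have hnx : n * x = 0 := by
      rw [← hq.mul_proj, ← hp.proj_mul_inv, mul_assoc, ← mul_assoc q, hqp, zero_mul, mul_zero]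
    rw [add_mul, mul_add, mul_add, hp.mul_inv, hq.mul_inv, hmy, hnx, add_zero, zero_add]
  inv_mul := by
    have hxn : x * n = 0 := by
      rw [← hp.inv_mul_proj, ← hq.proj_mul, mul_assoc, ← mul_assoc p, hpq, zero_mul, mul_zero]
    have hym : y * m = 0 := by
      rw [← hq.inv_mul_proj, ← hp.proj_mul, mul_assoc, ← mul_assoc q, hqp, zero_mul, mul_zero]
    rw [add_mul, mul_add, mul_add, hp.inv_mul, hq.inv_mul, hxn, hym, add_zero, zero_add]
  proj_mul := by
    have hpn : p * n = 0 := by rw [← hq.proj_mul, ← mul_assoc, hpq, zero_mul]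
    have hqm : q * m = 0 := by rw [← hp.proj_mul, ← mul_assoc, hqp, zero_mul]
    rw [add_mul, mul_add, mul_add, hp.proj_mul, hq.proj_mul, hpn, hqm, add_zero, zero_add]
  proj_mul_inv := by
    have hpy : p * y = 0 := by rw [← hq.proj_mul_inv, ← mul_assoc, hpq, zero_mul]
    have hqx : q * x = 0 := by rw [← hp.proj_mul_inv, ← mul_assoc, hqp, zero_mul]
    rw [add_mul, mul_add, mul_add, hp.proj_mul_inv, hq.proj_mul_inv, hpy, hqx, add_zero, zero_add]

section Ring

open Ring

variable {S : Type*} [Ring S] {p m x : S}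

theorem add_one_sub_mul_add_one_sub (h : IsCornerInverse p m x) :
    (m + (1 - p)) * (x + (1 - p)) = 1 := by
  rw [add_mul, mul_add, mul_add, mul_one_sub, h.mul_proj, h.mul_inv, one_sub_mul, h.proj_mul_inv,
    h.isIdempotentElem.one_sub.eq]
  abel

protected theorem symm (h : IsCornerInverse p m x) : IsCornerInverse p x m :=
  ⟨h.inv_mul, h.mul_inv, h.proj_mul_inv, h.proj_mul⟩

theorem inverse_add_one_sub (h : IsCornerInverse p m x) : (m + (1 - p))⁻¹ʳ = x + (1 - p) :=
  Ring.inverse_unit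
    ⟨_, _, h.add_one_sub_mul_add_one_sub, h.symm.add_one_sub_mul_add_one_sub⟩

theorem isUnit_add_one_sub (h : IsCornerInverse p m x) : IsUnit (m + (1 - p)) :=
  ⟨⟨_, _, h.add_one_sub_mul_add_one_sub, h.symm.add_one_sub_mul_add_one_sub⟩, rfl⟩

theorem exists_of_isUnit (hp : IsIdempotentElem p) (hpm : p * m = m) (hmp : m * p = m)
    (hu : IsUnit (m + (1 - p))) : ∃ x, IsCornerInverse p m x := by
  obtain ⟨u, hu⟩ := hu
  have hpu : p * u = m := by rw [hu, mul_add, hpm, hp.mul_one_sub_self, add_zero]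
  have hup : u * p = m := by rw [hu, add_mul, hmp, hp.one_sub_mul_self, add_zero]
  have hcomm : Commute p ↑u⁻¹ := Commute.units_inv_right (hpu.trans hup.symm)
  refine ⟨p * ↑u⁻¹, ?_, ?_, hpm, ?_⟩
  · rw [← mul_assoc, hmp, ← hpu, Units.mul_inv_cancel_right]
  · rw [hcomm.eq, mul_assoc, hpm, ← hup, Units.inv_mul_cancel_left]
  · rw [← mul_assoc, hp.eq]

end Ring

theorem tendsto {S ι : Type*} [NormedRing S] [HasSummableGeomSeries S] {l : Filter ι} {p m x : S}
    {m' x' : ι → S} (h : IsCornerInverse p m x) (hm : Tendsto m' l (𝓝 m))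
    (h' : ∀ᶠ i in l, IsCornerInverse p (m' i) (x' i)) : Tendsto x' l (𝓝 x) := by
  obtain ⟨u, hu⟩ := h.isUnit_add_one_sub
  have hinv := NormedRing.inverse_continuousAt u
  rw [ContinuousAt, hu, h.inverse_add_one_sub] at hinv
  have hlim := (hinv.comp (hm.add_const (1 - p))).sub_const (1 - p)
  rw [add_sub_cancel_right] at hlim
  refine hlim.congr' ?_
  filter_upwards [h'] with i hi
  rw [Function.comp_apply, hi.inverse_add_one_sub, add_sub_cancel_right]

end IsCornerInverse

end CornerInverse

section ObliqueProjection

/-- `P` and `R` are orthogonal projections and `F` is an idempotent with range `R` which vanishes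
on the complement of `P + R`, but not necessarily on `P`. -/
structure IsObliqueProjection {S : Type*} [Ring S] [StarRing S] (P R F : S) : Prop where
  isStarProjection_left : IsStarProjection P
  isStarProjection_right : IsStarProjection R
  proj_mul_proj : P * R = 0
  range_mul : R * F = F
  mul_range : F * R = R
  mul_proj_add_range : F * (P + R) = F

namespace IsObliqueProjection

variable {S : Type*} [Ring S] [StarRing S] {P R F : S}

theorem range_mul_proj (h : IsObliqueProjection P R F) : R * P = 0 := by
  have hstar := congrArg star h.proj_mul_proj
  rwa [star_mul, h.isStarProjection_left.isSelfAdjoint.star_eq,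
    h.isStarProjection_right.isSelfAdjoint.star_eq, star_zero] at hstar

theorem proj_mul (h : IsObliqueProjection P R F) : P * F = 0 := by
  rw [← h.range_mul, ← mul_assoc, h.proj_mul_proj, zero_mul]

theorem isIdempotentElem (h : IsObliqueProjection P R F) : IsIdempotentElem F := by
  rw [IsIdempotentElem]
  nth_rw 2 [← h.range_mul]
  rw [← mul_assoc, h.mul_range, h.range_mul]

theorem mul_proj_add (h : IsObliqueProjection P R F) : F * P + R = F := by
  rw [← h.mul_range, ← mul_add, h.mul_proj_add_range]

theorem mul_proj_mul_self (h : IsObliqueProjection P R F) : F * P * (F * P) = 0 := by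
  rw [mul_assoc, ← mul_assoc P, h.proj_mul, zero_mul, mul_zero]

/-- The unipotent `1 + F P`, which conjugates block diagonal elements for `P` and `R` into sums
`m + F* c F`. -/
def unipotent (h : IsObliqueProjection P R F) : Sˣ where
  val := 1 + F * P
  inv := 1 - F * P
  val_inv := by rw [add_mul, one_mul, mul_one_sub, h.mul_proj_mul_self]; abel
  inv_val := by rw [sub_mul, one_mul, mul_add, mul_one, h.mul_proj_mul_self]; abel

theorem commute_unipotent (h : IsObliqueProjection P R F) : Commute (P + R) h.unipotent := by
  have hleft : (P + R) * (F * P) = F * P := by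
    rw [add_mul, ← mul_assoc, ← mul_assoc, h.proj_mul, h.range_mul, zero_mul, zero_add]
  have hright : F * P * (P + R) = F * P := by
    rw [mul_add, mul_assoc, mul_assoc, h.isStarProjection_left.isIdempotentElem.eq,
      h.proj_mul_proj, mul_zero, add_zero]
  exact (Commute.one_right _).add_right (hleft.trans hright.symm)

theorem mul_unipotent (h : IsObliqueProjection P R F) {m : S} (hm : m * P = m) :
    m * h.unipotent = m := by
  change m * (1 + F * P) = m
  rw [mul_add, mul_one, ← mul_assoc, ← hm, mul_assoc m, h.proj_mul, mul_zero, zero_mul,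
    add_zero]

theorem range_mul_unipotent (h : IsObliqueProjection P R F) : R * h.unipotent = F := by
  change R * (1 + F * P) = F
  rw [mul_add, mul_one, ← mul_assoc, h.range_mul, add_comm, h.mul_proj_add]

theorem star_unipotent_mul_mul_unipotent (h : IsObliqueProjection P R F) {m : S} (c : S)
    (hPm : P * m = m) (hmP : m * P = m) :
    star (h.unipotent : S) * (m + R * c * R) * h.unipotent = m + star F * c * F := by
  have hstar : star (h.unipotent : S) * m = m := by
    have hm : star m * P = star m := by
      rw [← h.isStarProjection_left.isSelfAdjoint.star_eq, ← star_mul, hPm]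
    simpa only [star_mul, star_star] using congrArg star (h.mul_unipotent hm)
  have hrange : star (h.unipotent : S) * R = star F := by
    have hR := congrArg star h.range_mul_unipotent
    rwa [star_mul, h.isStarProjection_right.isSelfAdjoint.star_eq] at hR
  calc star (h.unipotent : S) * (m + R * c * R) * h.unipotent
      = star (h.unipotent : S) * m * h.unipotent
        + star (h.unipotent : S) * R * c * (R * h.unipotent) := by noncomm_ring
    _ = m + star F * c * F := by rw [hstar, hrange, h.mul_unipotent hmP, h.range_mul_unipotent]

theorem exists_isCornerInverse_add (h : IsObliqueProjection P R F) {m x c g : S}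
    (hm : IsCornerInverse P m x) (hc : IsCornerInverse R (R * c * R) g) :
    ∃ y, IsCornerInverse (P + R) (m + star F * c * F) y ∧ y * P = (1 - F) * x := by
  have hP := h.isStarProjection_left.isSelfAdjoint.star_eq
  have hstar : Commute (P + R) ↑(star h.unipotent) := by
    simpa [hP, h.isStarProjection_right.isSelfAdjoint.star_eq] using h.commute_unipotent.star_star
  have hblock := (hm.add hc h.proj_mul_proj h.range_mul_proj).units_conj h.commute_unipotent hstar
  rw [Units.coe_star, h.star_unipotent_mul_mul_unipotent c hm.proj_mul hm.mul_proj] at hblock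
  refine ⟨_, hblock, ?_⟩
  have hstarP : (↑(star h.unipotent)⁻¹ : S) * P = P := by
    have hPu := h.mul_unipotent h.isStarProjection_left.isIdempotentElem.eq
    rw [Units.inv_mul_eq_iff_eq_mul, Units.coe_star]
    simpa only [star_mul, hP] using (congrArg star hPu).symm
  have hgP : g * P = 0 := by rw [← hc.inv_mul_proj, mul_assoc, h.range_mul_proj, mul_zero]
  calc ↑h.unipotent⁻¹ * (x + g) * ↑(star h.unipotent)⁻¹ * P
      = ↑h.unipotent⁻¹ * x := by
        rw [mul_assoc, hstarP, mul_assoc, add_mul, hgP, hm.inv_mul_proj, add_zero]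
    _ = (1 - F * P) * x := rfl
    _ = (1 - F) * x := by rw [sub_mul, sub_mul, mul_assoc, hm.proj_mul_inv]

theorem one_sub_mul_mul_proj (h : IsObliqueProjection P R F) {Q s : S} (hQ : IsSelfAdjoint Q)
    (hFQ : F * Q = F) (hQF : Q * F = Q) (hgs : ((1 - P) + (1 - Q)) * s = 1)
    (hsg : s * ((1 - P) + (1 - Q)) = 1) : (1 - P) * s * P = F * P := by
  have hP := h.isStarProjection_left
  have hRs : R * s = F := by
    have hFg : F * ((1 - P) + (1 - Q)) = R := by
      rw [mul_add, mul_sub, mul_sub, hFQ, mul_one, sub_self, add_zero, sub_eq_iff_eq_add',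
        h.mul_proj_add]
    rw [← hFg, mul_assoc, hgs, mul_one]
  have hadd : star (P + R) = P + R := by
    rw [star_add, hP.isSelfAdjoint.star_eq, h.isStarProjection_right.isSelfAdjoint.star_eq]
  have haddP : (P + R) * P = P := by
    rw [add_mul, hP.isIdempotentElem.eq, h.range_mul_proj, add_zero]
  have hPadd : P * (P + R) = P := by
    rw [mul_add, hP.isIdempotentElem.eq, h.proj_mul_proj, add_zero]
  have hQadd : Q * (P + R) = Q := by rw [← hQF, mul_assoc, h.mul_proj_add_range]
  have haddQ : (P + R) * Q = Q := by
    simpa only [star_mul, hadd, hQ.star_eq] using congrArg star hQadd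
  have hcomm : Commute (P + R) s := by
    have hg : Commute (P + R) ((1 - P) + (1 - Q)) := by
      refine .add_right (.sub_right (.one_right _) ?_) (.sub_right (.one_right _) ?_)
      · exact haddP.trans hPadd.symm
      · exact haddQ.trans hQadd.symm
    exact Commute.units_inv_right (u := ⟨_, s, hgs, hsg⟩) hg
  calc (1 - P) * s * P = s * P - (P + R) * s * P + R * s * P := by noncomm_ring
    _ = F * P := by rw [hcomm.eq, mul_assoc s, haddP, sub_self, zero_add, hRs]

end IsObliqueProjection

/-- The inverse `g` of `R b R` in the corner of `R` is the inverse of a block of `b`, and `g b` is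
the associated block elimination (Schur complement) idempotent. -/
theorem IsCornerInverse.isObliqueProjection {S : Type*} [Ring S] [StarRing S] {P R b g : S}
    (h : IsCornerInverse R (R * b * R) g) (hP : IsStarProjection P) (hR : IsStarProjection R)
    (hPR : P * R = 0) (hb : b * (P + R) = b) : IsObliqueProjection P R (g * b) where
  isStarProjection_left := hP
  isStarProjection_right := hR
  proj_mul_proj := hPR
  range_mul := by rw [← mul_assoc, h.proj_mul_inv]
  mul_range := by
    nth_rw 1 [← h.inv_mul_proj]
    simpa only [mul_assoc] using h.inv_mul
  mul_proj_add_range := by rw [mul_assoc, hb]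

end ObliqueProjection

section CStarAlgebra

variable {S : Type*} [CStarAlgebra S]

section Order

variable [PartialOrder S] [StarOrderedRing S]

theorem isUnit_of_one_le_smul {m : S} {c : ℝ} (hc : 0 < c) (h : 1 ≤ c • m) : IsUnit m := by
  have hu : IsUnit (c • m) := CStarAlgebra.isUnit_of_le _ h isStrictlyPositive_one
  exact (isUnit_smul_iff (Units.mk0 c hc.ne') m).1 hu

theorem isUnit_add_of_add_eq_one {u v z w : S} {c d : ℝ} (huv : u + v = 1)
    (hz : 0 ≤ z) (hw : 0 ≤ w) (hu : star u * u ≤ c • z) (hv : star v * v ≤ d • w) :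
    IsUnit (z + w) := by
  have hone : 1 ≤ (2 : ℝ) • (star u * u + star v * v) := by
    have hparallelogram : (2 : ℝ) • (star u * u + star v * v) =
        star (u + v) * (u + v) + star (u - v) * (u - v) := by
      rw [two_smul, star_add, star_sub]; noncomm_ring
    rw [hparallelogram, huv, star_one, one_mul]
    exact le_add_of_nonneg_right (star_mul_self_nonneg _)
  set b := max 1 (max c d)
  refine isUnit_of_one_le_smul (c := 2 * b) (by positivity) (hone.trans ?_)
  rw [mul_smul, smul_add b]
  have hcb : c ≤ b := (le_max_left _ _).trans (le_max_right _ _)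
  have hdb : d ≤ b := (le_max_right _ _).trans (le_max_right _ _)
  exact smul_le_smul_of_nonneg_left
    (add_le_add (hu.trans (smul_le_smul_of_nonneg_right hcb hz))
      (hv.trans (smul_le_smul_of_nonneg_right hdb hw))) zero_le_two

theorem IsCornerInverse.exists_of_le_smul {q m : S} {c : ℝ} (hq : IsStarProjection q)
    (hm : 0 ≤ m) (hmq : m * q = m) (h : q ≤ c • m) : ∃ x, IsCornerInverse q m x := by
  have hqm : q * m = m := by
    simpa only [star_mul, hq.isSelfAdjoint.star_eq, hm.isSelfAdjoint.star_eq]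
      using congrArg star hmq
  have hunit : IsUnit (m + (1 - q)) := by
    refine isUnit_add_of_add_eq_one (c := c) (d := 1) (add_sub_cancel q 1) hm hq.one_sub_nonneg
      ?_ ?_
    · rwa [hq.isSelfAdjoint.star_eq, hq.isIdempotentElem.eq]
    · rw [hq.one_sub.isSelfAdjoint.star_eq, hq.one_sub.isIdempotentElem.eq, one_smul]
  exact exists_of_isUnit hq.isIdempotentElem hqm hmq hunit

theorem star_mul_mul_le_norm_smul {r : S} (a : S) (hr : IsStarProjection r) :
    star (a * r) * (a * r) ≤ ‖star a * a‖ • r := by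
  have h := CStarAlgebra.star_left_conjugate_le_norm_smul (a := r) (b := star a * a)
  rwa [hr.isSelfAdjoint.star_eq, hr.isIdempotentElem.eq, mul_assoc, mul_assoc, ← mul_assoc r,
    ← hr.isSelfAdjoint.star_eq, ← star_mul, hr.isSelfAdjoint.star_eq] at h

end Order

theorem isUnit_one_sub_add_one_sub {p q f : S} (hp : IsStarProjection p)
    (hq : IsStarProjection q) (hpf : p * f = 0) (hqf : q * f = q) :
    IsUnit ((1 - p) + (1 - q)) := by
  let _ := CStarAlgebra.spectralOrder S
  have := CStarAlgebra.spectralOrderedRing S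
  have hfp : star f * p = 0 := by
    rw [← hp.isSelfAdjoint.star_eq, ← star_mul, hpf, star_zero]
  have hfq : star f * q = q := by
    nth_rw 1 [← hq.isSelfAdjoint.star_eq]
    rw [← star_mul, hqf, hq.isSelfAdjoint.star_eq]
  have hsum : star f * (1 - p) + (1 - star f) * (1 - q) = 1 := by
    rw [mul_one_sub, mul_one_sub, sub_mul, one_mul, hfp, hfq]; abel
  exact isUnit_add_of_add_eq_one hsum hp.one_sub_nonneg hq.one_sub_nonneg
    (star_mul_mul_le_norm_smul _ hp.one_sub) (star_mul_mul_le_norm_smul _ hq.one_sub)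

theorem exists_isStarProjection_of_isIdempotentElem {e : S} (he : IsIdempotentElem e) :
    ∃ q, IsStarProjection q ∧ e * q = e ∧ q * e = q := by
  let _ := CStarAlgebra.spectralOrder S
  have := CStarAlgebra.spectralOrderedRing S
  have hes : star e * star e = star e := by rw [← star_mul, he.eq]
  obtain ⟨z, hz⟩ : IsUnit (1 + star (e - star e) * (e - star e)) :=
    isUnit_of_one_le_smul one_pos (by
      rw [one_smul]; exact le_add_of_nonneg_right (star_mul_self_nonneg _))
  have hz' : (z : S) = 1 - e + e * star e + star e * e - star e := by
    rw [hz, star_sub, star_star, sub_mul, mul_sub, mul_sub, he.eq, hes]; abel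
  have hez : e * z = e * star e * e := by
    rw [hz', mul_sub, mul_add, mul_add, mul_sub, mul_one, ← mul_assoc, ← mul_assoc, he.eq]; abel
  have hze : z * e = e * star e * e := by
    rw [hz', sub_mul, add_mul, add_mul, sub_mul, one_mul, mul_assoc _ e e, he.eq]; abel
  have hcomm : Commute e ↑z⁻¹ := Commute.units_inv_right (hez.trans hze.symm)
  have hzs : star (↑z⁻¹ : S) = ↑z⁻¹ := by
    have : star z = z := Units.ext (by rw [Units.coe_star, hz]; simp)
    rw [← Units.coe_star_inv, this]
  have hcomms : Commute (star e) ↑z⁻¹ := by simpa only [hzs] using hcomm.star_star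
  set q := star e * e * ↑z⁻¹
  have heq : e * q = e := by
    rw [← mul_assoc, ← mul_assoc, ← hez, Units.mul_inv_cancel_right]
  have hqe : q * e = q := by rw [mul_assoc, ← hcomm.eq, ← mul_assoc, mul_assoc _ e e, he.eq]
  refine ⟨q, ⟨?_, ?_⟩, heq, hqe⟩
  · rw [IsIdempotentElem]
    nth_rw 1 [← hqe]
    rw [mul_assoc, heq, hqe]
  · rw [IsSelfAdjoint, star_mul, star_mul, star_star, hzs, ← (hcomms.mul_left hcomm).eq]

end CStarAlgebra

section AdjointableOperators

variable {𝔄 : Type*} [NonUnitalCStarAlgebra 𝔄] [PartialOrder 𝔄]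
  {H : Type*} [NormedAddCommGroup H] [NormedSpace ℂ H] [SMul 𝔄 H] [CStarModule 𝔄 H]
  {K : Type*} [NormedAddCommGroup K] [NormedSpace ℂ K] [SMul 𝔄 K] [CStarModule 𝔄 K]
  {E : Type*} [NormedAddCommGroup E] [NormedSpace ℂ E] [SMul 𝔄 E] [CStarModule 𝔄 E]
  {L : Type*} [NormedAddCommGroup L] [NormedSpace ℂ L] [SMul 𝔄 L] [CStarModule 𝔄 L]

namespace AdjOp

theorem ext_apply {S T : AdjOp 𝔄 H K} (h : ∀ x, S.1 x = T.1 x) : S = T :=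
  Subtype.ext (ContinuousLinearMap.ext h)

variable [StarOrderedRing 𝔄]

theorem eq_adj_of_inner {T : AdjOp 𝔄 H K} {S : AdjOp 𝔄 K H}
    (h : ∀ x y, inner 𝔄 (T.1 x) y = inner 𝔄 x (S.1 y)) : T.adj = S :=
  ext_apply fun y => eq_of_forall_inner_eq (𝔄 := 𝔄) fun x => by rw [← inner_adj, h]

theorem inner_adj_left (T : AdjOp 𝔄 H K) (x : H) (y : K) :
    inner 𝔄 (T.adj.1 y) x = inner 𝔄 y (T.1 x) := by
  rw [← CStarModule.star_inner, ← inner_adj, CStarModule.star_inner]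

@[simp] theorem comp_apply (T : AdjOp 𝔄 K E) (S : AdjOp 𝔄 H K) (x : H) :
    (T ⬝ S).1 x = T.1 (S.1 x) := rfl

@[simp] theorem adj_adj (T : AdjOp 𝔄 H K) : T.adj.adj = T :=
  eq_adj_of_inner fun x y => inner_adj_left T y x

@[simp] theorem adj_comp (T : AdjOp 𝔄 K E) (S : AdjOp 𝔄 H K) :
    (T ⬝ S).adj = S.adj ⬝ T.adj :=
  eq_adj_of_inner fun x y => by simp [inner_adj]

@[simp] theorem adj_add (S T : AdjOp 𝔄 H K) : (S + T).adj = S.adj + T.adj :=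
  eq_adj_of_inner fun x y => by simp [inner_adj]

@[simp] theorem adj_sub (S T : AdjOp 𝔄 H K) : (S - T).adj = S.adj - T.adj :=
  eq_adj_of_inner fun x y => by simp [inner_adj]

@[simp] theorem adj_zero : (0 : AdjOp 𝔄 H K).adj = 0 :=
  eq_adj_of_inner fun x y => by simp

@[simp] theorem adj_smul (c : ℂ) (T : AdjOp 𝔄 H K) : (c • T).adj = star c • T.adj :=
  eq_adj_of_inner fun x y => by simp [inner_adj]

@[simp] theorem adj_idOp : (idOp 𝔄 H).adj = idOp 𝔄 H :=
  eq_adj_of_inner fun _ _ => rfl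

theorem comp_assoc (T : AdjOp 𝔄 E L) (S : AdjOp 𝔄 K E) (R : AdjOp 𝔄 H K) :
    (T ⬝ S) ⬝ R = T ⬝ S ⬝ R := rfl

@[simp] theorem idOp_comp (T : AdjOp 𝔄 H K) : idOp 𝔄 K ⬝ T = T := rfl

@[simp] theorem comp_idOp (T : AdjOp 𝔄 H K) : T ⬝ idOp 𝔄 H = T := rfl

theorem add_comp (S T : AdjOp 𝔄 K E) (R : AdjOp 𝔄 H K) : (S + T) ⬝ R = S ⬝ R + T ⬝ R := rfl

theorem sub_comp (S T : AdjOp 𝔄 K E) (R : AdjOp 𝔄 H K) : (S - T) ⬝ R = S ⬝ R - T ⬝ R := rfl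

theorem comp_add (T : AdjOp 𝔄 K E) (S R : AdjOp 𝔄 H K) : T ⬝ (S + R) = T ⬝ S + T ⬝ R :=
  ext_apply fun _ => map_add T.1 _ _

theorem comp_sub (T : AdjOp 𝔄 K E) (S R : AdjOp 𝔄 H K) : T ⬝ (S - R) = T ⬝ S - T ⬝ R :=
  ext_apply fun _ => map_sub T.1 _ _

@[simp] theorem smul_comp (c : ℂ) (T : AdjOp 𝔄 K E) (S : AdjOp 𝔄 H K) :
    (c • T) ⬝ S = c • (T ⬝ S) := rfl

@[simp] theorem comp_smul (c : ℂ) (T : AdjOp 𝔄 K E) (S : AdjOp 𝔄 H K) :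
    T ⬝ (c • S) = c • (T ⬝ S) :=
  ext_apply fun _ => map_smul T.1 _ _

@[simp] theorem zero_comp (S : AdjOp 𝔄 H K) : (0 : AdjOp 𝔄 K E) ⬝ S = 0 := rfl

@[simp] theorem comp_zero (T : AdjOp 𝔄 K E) : T ⬝ (0 : AdjOp 𝔄 H K) = 0 :=
  ext_apply fun _ => map_zero T.1

theorem norm_comp_le (T : AdjOp 𝔄 K E) (S : AdjOp 𝔄 H K) : ‖T ⬝ S‖ ≤ ‖T‖ * ‖S‖ :=
  ContinuousLinearMap.opNorm_comp_le T.1 S.1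

theorem continuous_comp_left (S : AdjOp 𝔄 H K) :
    Continuous fun T : AdjOp 𝔄 K E => T ⬝ S :=
  (continuous_subtype_val.clm_comp continuous_const).subtype_mk _

theorem sq_norm_le_norm_adj_comp_self (T : AdjOp 𝔄 H K) : ‖T‖ * ‖T‖ ≤ ‖T.adj ⬝ T‖ := by
  have h : ‖T‖ ≤ √‖T.adj ⬝ T‖ := by
    refine ContinuousLinearMap.opNorm_le_bound _ (Real.sqrt_nonneg _) fun x => ?_
    change ‖T.1 x‖ ≤ _
    refine (Real.le_sqrt_of_sq_le ?_ : _ ≤ √(‖T.adj ⬝ T‖ * ‖x‖ ^ 2)).trans_eq ?_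
    · rw [CStarModule.norm_sq_eq (A := 𝔄), inner_adj]
      refine (CStarModule.norm_inner_le H).trans ?_
      have := (T.adj ⬝ T).1.le_opNorm x
      calc ‖x‖ * ‖T.adj.1 (T.1 x)‖ ≤ ‖x‖ * (‖T.adj ⬝ T‖ * ‖x‖) := by gcongr; exact this
        _ = _ := by ring
    · rw [Real.sqrt_mul (norm_nonneg (T.adj ⬝ T)), Real.sqrt_sq (norm_nonneg x)]
  calc ‖T‖ * ‖T‖ ≤ √‖T.adj ⬝ T‖ * √‖T.adj ⬝ T‖ := by gcongr
    _ = _ := Real.mul_self_sqrt (norm_nonneg _)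

theorem norm_le_norm_adj (T : AdjOp 𝔄 H K) : ‖T‖ ≤ ‖T.adj‖ := by
  rcases (norm_nonneg T).eq_or_lt with h | h
  · rw [← h]; exact norm_nonneg _
  · exact le_of_mul_le_mul_right
      ((sq_norm_le_norm_adj_comp_self T).trans (norm_comp_le _ _)) h

@[simp] theorem norm_adj (T : AdjOp 𝔄 H K) : ‖T.adj‖ = ‖T‖ :=
  le_antisymm (by simpa using norm_le_norm_adj T.adj) (norm_le_norm_adj T)

scoped instance [CompleteSpace H] [CompleteSpace K] : CompleteSpace (AdjOp 𝔄 H K) := by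
  refine Metric.complete_of_cauchySeq_tendsto fun u hu => ?_
  have hu' : CauchySeq fun n => (u n).adj := by
    rw [Metric.cauchySeq_iff] at hu ⊢
    have h (m n : ℕ) : dist (u m).adj (u n).adj = dist (u m) (u n) := by
      rw [dist_eq_norm, ← adj_sub, dist_eq_norm]
      exact norm_adj _
    simpa only [h] using hu
  have hv : CauchySeq fun n => (u n).1 := uniformContinuous_subtype_val.comp_cauchySeq hu
  have hv' : CauchySeq fun n => (u n).adj.1 := uniformContinuous_subtype_val.comp_cauchySeq hu'
  obtain ⟨T, hT⟩ := cauchySeq_tendsto_of_complete hv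
  obtain ⟨S, hS⟩ := cauchySeq_tendsto_of_complete hv'
  refine ⟨⟨T, S, fun x y => ?_⟩, tendsto_subtype_rng.2 hT⟩
  have hTx : Tendsto (fun n => (u n).1 x) atTop (𝓝 (T x)) :=
    ((ContinuousLinearMap.apply ℂ K x).continuous.tendsto T).comp hT
  have hSy : Tendsto (fun n => (u n).adj.1 y) atTop (𝓝 (S y)) :=
    ((ContinuousLinearMap.apply ℂ H y).continuous.tendsto S).comp hS
  have h1 := (CStarModule.continuous_inner (A := 𝔄) (E := K)).tendsto (T x, y) |>.comp
    (hTx.prodMk_nhds tendsto_const_nhds)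
  have h2 := (CStarModule.continuous_inner (A := 𝔄) (E := H)).tendsto (x, S y) |>.comp
    (tendsto_const_nhds.prodMk_nhds hSy)
  exact tendsto_nhds_unique (h1.congr fun n => inner_adj (u n) x y) h2

scoped instance : NormedRing (AdjOp 𝔄 H H) where
  __ := Submodule.normedAddCommGroup (adjointable 𝔄 H H)
  mul := comp
  one := idOp 𝔄 H
  mul_assoc _ _ _ := rfl
  one_mul _ := rfl
  mul_one _ := rfl
  zero_mul _ := rfl
  mul_zero := comp_zero
  left_distrib := comp_add
  right_distrib _ _ _ := rfl
  norm_mul_le := norm_comp_le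

scoped instance : StarRing (AdjOp 𝔄 H H) where
  star := adj
  star_involutive := adj_adj
  star_mul := adj_comp
  star_add := adj_add

theorem adj_eq_star (T : AdjOp 𝔄 H H) : T.adj = star T := rfl

scoped instance : NormedAlgebra ℂ (AdjOp 𝔄 H H) where
  __ := Algebra.ofModule (R := ℂ) (A := AdjOp 𝔄 H H) (fun _ _ _ => rfl) comp_smul
  norm_smul_le c T := norm_smul_le c T.1

scoped instance [CompleteSpace H] : CStarAlgebra (AdjOp 𝔄 H H) where
  norm_mul_self_le := sq_norm_le_norm_adj_comp_self
  star_smul := adj_smul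

scoped instance [CompleteSpace H] : PartialOrder (AdjOp 𝔄 H H) := CStarAlgebra.spectralOrder _

scoped instance [CompleteSpace H] : StarOrderedRing (AdjOp 𝔄 H H) :=
  CStarAlgebra.spectralOrderedRing _

theorem adj_comp_self_add_eq_zero {S : AdjOp 𝔄 H K} {T : AdjOp 𝔄 H E}
    (h : S.adj ⬝ S + T.adj ⬝ T = 0) : S = 0 ∧ T = 0 := by
  have hinner (x : H) : inner 𝔄 (S.1 x) (S.1 x) + inner 𝔄 (T.1 x) (T.1 x) = (0 : 𝔄) := by
    rw [inner_adj, inner_adj, ← CStarModule.inner_add_right]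
    exact (congrArg (fun Z : AdjOp 𝔄 H H => inner 𝔄 x (Z.1 x)) h).trans (by simp)
  have hzero (x : H) := (add_eq_zero_iff_of_nonneg CStarModule.inner_self_nonneg
    CStarModule.inner_self_nonneg).1 (hinner x)
  exact ⟨ext_apply fun x => CStarModule.inner_self.1 (hzero x).1,
    ext_apply fun x => CStarModule.inner_self.1 (hzero x).2⟩

theorem comp_eq_zero_of_adj_comp_self_add_comp_eq_zero {S : AdjOp 𝔄 H K} {T : AdjOp 𝔄 H E}
    {X : AdjOp 𝔄 L H} (h : (S.adj ⬝ S + T.adj ⬝ T) ⬝ X = 0) : S ⬝ X = 0 ∧ T ⬝ X = 0 := by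
  refine adj_comp_self_add_eq_zero ?_
  calc (S ⬝ X).adj ⬝ (S ⬝ X) + (T ⬝ X).adj ⬝ (T ⬝ X)
      = X.adj ⬝ (S.adj ⬝ S + T.adj ⬝ T) ⬝ X := by
        simp only [adj_comp, comp_assoc, add_comp, comp_add]
    _ = 0 := by rw [h, comp_zero]

/-- With `a = S* S`, the element `a⁻ a a⁻ = -(a⁻)³` is both of the form `X* X` and `-Y* Y`, hence
it vanishes. -/
theorem adj_comp_self_nonneg [CompleteSpace H] (S : AdjOp 𝔄 H K) : 0 ≤ S.adj ⬝ S := by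
  set a : AdjOp 𝔄 H H := S.adj ⬝ S with ha
  have hsa : IsSelfAdjoint a := by
    change a.adj = a
    rw [ha, adj_comp, adj_adj]
  have hneg : 0 ≤ a⁻ := CFC.negPart_nonneg a
  obtain ⟨s, hs⟩ := CStarAlgebra.nonneg_iff_eq_star_mul_self.1 hneg
  have hcube : a⁻ * a * a⁻ = -(a⁻ * a⁻ * a⁻) := by
    conv_lhs => enter [1, 2]; rw [← CFC.posPart_sub_negPart a hsa]
    rw [mul_sub, CFC.negPart_mul_posPart, zero_sub, neg_mul]
  have hS : (S ⬝ a⁻).adj ⬝ (S ⬝ a⁻) = a⁻ * a * a⁻ := by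
    rw [adj_comp, adj_eq_star, hneg.isSelfAdjoint.star_eq]; rfl
  have hsneg : (s * a⁻).adj ⬝ (s * a⁻) = a⁻ * a⁻ * a⁻ := by
    change star (s * a⁻) * (s * a⁻) = _
    rw [star_mul, hneg.isSelfAdjoint.star_eq, mul_assoc, ← mul_assoc (star s), ← hs, mul_assoc]
  have hzero : s * a⁻ = 0 :=
    (adj_comp_self_add_eq_zero (by rw [hS, hsneg, hcube, neg_add_cancel])).2
  have hsq : star a⁻ * a⁻ = 0 := by
    rw [hneg.isSelfAdjoint.star_eq]
    nth_rw 1 [hs]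
    rw [mul_assoc, hzero, mul_zero]
  exact (CFC.negPart_eq_zero_iff a hsa).1 (CStarRing.star_mul_self_eq_zero_iff _ |>.1 hsq)

theorem conj_nonneg [CompleteSpace H] [CompleteSpace K] {M : AdjOp 𝔄 K K} (hM : 0 ≤ M)
    (S : AdjOp 𝔄 H K) : 0 ≤ S.adj ⬝ M ⬝ S := by
  obtain ⟨T, rfl⟩ := CStarAlgebra.nonneg_iff_eq_star_mul_self.1 hM
  have h := adj_comp_self_nonneg (T ⬝ S)
  rwa [adj_comp] at h

theorem adj_comp_self_le_norm_smul [CompleteSpace H] [CompleteSpace K] (X : AdjOp 𝔄 K E)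
    (S : AdjOp 𝔄 H K) : (X ⬝ S).adj ⬝ (X ⬝ S) ≤ ‖X.adj ⬝ X‖ • (S.adj ⬝ S) := by
  have hX : X.adj ⬝ X ≤ algebraMap ℝ _ ‖X.adj ⬝ X‖ :=
    (adj_comp_self_nonneg X).isSelfAdjoint.le_algebraMap_norm_self
  have h := conj_nonneg (sub_nonneg.2 hX) S
  rw [sub_comp, comp_sub, sub_nonneg, Algebra.algebraMap_eq_smul_one, ← Complex.coe_smul,
    smul_comp, comp_smul, Complex.coe_smul] at h
  rw [adj_comp]
  exact h

end AdjOp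

end AdjointableOperators

section MoorePenrose

open scoped AdjOp

variable {𝔄 : Type*} [NonUnitalCStarAlgebra 𝔄] [PartialOrder 𝔄] [StarOrderedRing 𝔄]
  {H : Type*} [NormedAddCommGroup H] [NormedSpace ℂ H] [SMul 𝔄 H] [CStarModule 𝔄 H]
  {K : Type*} [NormedAddCommGroup K] [NormedSpace ℂ K] [SMul 𝔄 K] [CStarModule 𝔄 K]
  {E : Type*} [NormedAddCommGroup E] [NormedSpace ℂ E] [SMul 𝔄 E] [CStarModule 𝔄 E]

namespace AdjOp

theorem IsMPInverse.unique {T : AdjOp 𝔄 H K} {X Y : AdjOp 𝔄 K H} (hX : T.IsMPInverse X)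
    (hY : T.IsMPInverse Y) : X = Y := by
  have hleft : T ⬝ X = T ⬝ Y := by
    calc T ⬝ X = (T ⬝ Y ⬝ T) ⬝ X := by rw [hY.mul_mul_self]
      _ = ((T ⬝ X) ⬝ T ⬝ Y).adj := by rw [adj_comp, hX.adj_left, hY.adj_left]; rfl
      _ = ((T ⬝ X ⬝ T) ⬝ Y).adj := rfl
      _ = T ⬝ Y := by rw [hX.mul_mul_self, hY.adj_left]
  have hright : X ⬝ T = Y ⬝ T := by
    calc X ⬝ T = X ⬝ (T ⬝ Y ⬝ T) := by rw [hY.mul_mul_self]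
      _ = ((Y ⬝ T) ⬝ X ⬝ T).adj := by rw [adj_comp, hX.adj_right, hY.adj_right]; rfl
      _ = (Y ⬝ T ⬝ X ⬝ T).adj := rfl
      _ = Y ⬝ T := by rw [hX.mul_mul_self, hY.adj_right]
  calc X = X ⬝ T ⬝ X := hX.self_mul_mul.symm
    _ = (X ⬝ T) ⬝ Y := by rw [hleft]; rfl
    _ = Y := by rw [hright]; exact hY.self_mul_mul

theorem MPInvertible.isMPInverse_mpInv {T : AdjOp 𝔄 H K} (h : T.MPInvertible) :
    T.IsMPInverse T.mpInv := by
  rw [mpInv, dif_pos h]; exact h.choose_spec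

theorem IsMPInverse.mpInv_eq {T : AdjOp 𝔄 H K} {X : AdjOp 𝔄 K H} (h : T.IsMPInverse X) :
    T.mpInv = X :=
  (MPInvertible.isMPInverse_mpInv ⟨X, h⟩).unique h

theorem IsMPInverse.isStarProjection {T : AdjOp 𝔄 H K} {X : AdjOp 𝔄 K H}
    (h : T.IsMPInverse X) : IsStarProjection (X ⬝ T) where
  isIdempotentElem := congrArg (X ⬝ ·) h.mul_mul_self
  isSelfAdjoint := h.adj_right

theorem IsMPInverse.comp_comp_adj {T : AdjOp 𝔄 H K} {X : AdjOp 𝔄 K H} (h : T.IsMPInverse X) :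
    (X ⬝ T) ⬝ T.adj = T.adj := by
  have hadj := congrArg adj h.mul_mul_self
  rwa [adj_comp, h.adj_right] at hadj

theorem invertible_iff_isUnit {T : AdjOp 𝔄 H H} : T.Invertible ↔ IsUnit T :=
  ⟨fun ⟨X, hXT, hTX⟩ => ⟨⟨T, X, hTX, hXT⟩, rfl⟩,
    fun ⟨u, hu⟩ => hu ▸ ⟨↑u⁻¹, u.inv_mul, u.mul_inv⟩⟩

theorem Invertible.isInverse_inverse {T : AdjOp 𝔄 H H} (h : T.Invertible) :
    T.IsInverse T.inverse := by
  rw [inverse, dif_pos h]; exact h.choose_spec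

theorem posDefinite_idOp : (idOp 𝔄 H).PosDefinite where
  selfAdjoint := adj_idOp
  invertible := ⟨idOp 𝔄 H, rfl, rfl⟩
  positive := ⟨idOp 𝔄 H, by rw [adj_idOp, idOp_comp]⟩

theorem PosDefinite.nonneg [CompleteSpace H] {M : AdjOp 𝔄 H H} (hM : M.PosDefinite) : 0 ≤ M := by
  obtain ⟨S, rfl⟩ := hM.positive
  exact adj_comp_self_nonneg S

theorem PosDefinite.smul {M : AdjOp 𝔄 H H} (hM : M.PosDefinite) {t : ℝ} (ht : 0 < t) :
    ((t : ℂ) • M).PosDefinite where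
  selfAdjoint := by rw [adj_smul, hM.selfAdjoint, Complex.star_def, Complex.conj_ofReal]
  invertible := by
    obtain ⟨X, hXM, hMX⟩ := hM.invertible
    have ht' : (t : ℂ) ≠ 0 := Complex.ofReal_ne_zero.2 ht.ne'
    refine ⟨(t : ℂ)⁻¹ • X, ?_, ?_⟩
    · rw [smul_comp, comp_smul, inv_smul_smul₀ ht', hXM]
    · rw [smul_comp, comp_smul, smul_inv_smul₀ ht', hMX]
  positive := by
    obtain ⟨S, hS⟩ := hM.positive
    refine ⟨(√t : ℂ) • S, ?_⟩
    rw [adj_smul, smul_comp, comp_smul, smul_smul, ← hS, Complex.star_def, Complex.conj_ofReal,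
      ← Complex.ofReal_mul, Real.mul_self_sqrt ht.le]

theorem PosDefinite.exists_le_smul [CompleteSpace H] [CompleteSpace K] {V : AdjOp 𝔄 K K}
    (hV : V.PosDefinite) {S : AdjOp 𝔄 H K} {X : AdjOp 𝔄 K H} (hXS : IsStarProjection (X ⬝ S)) :
    ∃ c : ℝ, 0 ≤ c ∧ X ⬝ S ≤ c • (S.adj ⬝ V ⬝ S) := by
  obtain ⟨T, hT⟩ := hV.positive
  obtain ⟨Y, hYV, -⟩ := hV.invertible
  have hfactor : (X ⬝ Y ⬝ T.adj) ⬝ (T ⬝ S) = X ⬝ S := by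
    calc (X ⬝ Y ⬝ T.adj) ⬝ (T ⬝ S) = X ⬝ (Y ⬝ (T.adj ⬝ T)) ⬝ S := rfl
      _ = X ⬝ S := by rw [← hT, hYV, idOp_comp]
  have hproj : (X ⬝ S).adj ⬝ (X ⬝ S) = X ⬝ S := by
    rw [adj_eq_star (X ⬝ S), hXS.isSelfAdjoint.star_eq]
    exact hXS.isIdempotentElem.eq
  have hTS : (T ⬝ S).adj ⬝ (T ⬝ S) = S.adj ⬝ V ⬝ S := by
    rw [hT, adj_comp]; rfl
  have h := adj_comp_self_le_norm_smul (X ⬝ Y ⬝ T.adj) (T ⬝ S)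
  rw [hfactor, hproj, hTS] at h
  exact ⟨_, norm_nonneg _, h⟩

end AdjOp

theorem IsCornerInverse.isMPInverse {p M X : AdjOp 𝔄 H H} (h : IsCornerInverse p M X)
    (hp : p.adj = p) : M.IsMPInverse X where
  mul_mul_self := (congrArg (M ⬝ ·) h.inv_mul).trans h.mul_proj
  self_mul_mul := (congrArg (X ⬝ ·) h.mul_inv).trans h.inv_mul_proj
  adj_left := (congrArg AdjOp.adj h.mul_inv).trans (hp.trans h.mul_inv.symm)
  adj_right := (congrArg AdjOp.adj h.inv_mul).trans (hp.trans h.inv_mul.symm)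

namespace AdjOp

theorem PosDefinite.isCornerInverse_mpInv [CompleteSpace H] [CompleteSpace K] {V : AdjOp 𝔄 K K}
    (hV : V.PosDefinite) {S : AdjOp 𝔄 H K} {X : AdjOp 𝔄 K H} {q M : AdjOp 𝔄 H H}
    (hq : IsStarProjection q) (hXS : X ⬝ S = q) (hSq : S ⬝ q = S) (hM : 0 ≤ M)
    (hMq : M * q = M) :
    IsCornerInverse q (S.adj ⬝ V ⬝ S + M) (S.adj ⬝ V ⬝ S + M).mpInv := by
  have hSVS : 0 ≤ S.adj ⬝ V ⬝ S := conj_nonneg hV.nonneg S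
  obtain ⟨c, hc, hle⟩ := hV.exists_le_smul (hXS ▸ hq)
  rw [hXS] at hle
  obtain ⟨x, hx⟩ := IsCornerInverse.exists_of_le_smul hq (add_nonneg hSVS hM)
    (by rw [add_mul, hMq]; exact congrArg (S.adj ⬝ V ⬝ · + M) hSq)
    (hle.trans (smul_le_smul_of_nonneg_left (le_add_of_nonneg_right hM) hc))
  rwa [(hx.isMPInverse hq.isSelfAdjoint).mpInv_eq]

theorem mpInvertible_of_comp_comp_self [CompleteSpace H] [CompleteSpace K] {T : AdjOp 𝔄 H K}
    {X : AdjOp 𝔄 K H} (h : T ⬝ X ⬝ T = T) : T.MPInvertible := by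
  have hidem : IsIdempotentElem (X ⬝ T) := congrArg (X ⬝ ·) h
  obtain ⟨q, hq, hXTq, hqXT⟩ := exists_isStarProjection_of_isIdempotentElem hidem
  have hTq : T ⬝ q = T := by
    calc T ⬝ q = (T ⬝ X ⬝ T) ⬝ q := by rw [h]
      _ = T ⬝ ((X ⬝ T) * q) := rfl
      _ = T := by rw [hXTq, h]
  have hg := posDefinite_idOp.isCornerInverse_mpInv (X := q ⬝ X) hq hqXT hTq le_rfl (zero_mul q)
  rw [add_zero, idOp_comp] at hg
  set g := (T.adj ⬝ T).mpInv
  have hgT : (g ⬝ T.adj) ⬝ T = q := hg.inv_mul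
  have hgs : g.adj = g := hg.isSelfAdjoint hq.isSelfAdjoint (adj_comp_self_nonneg T).isSelfAdjoint
  refine ⟨g ⬝ T.adj, ?_, ?_, ?_, ?_⟩
  · rw [hgT, hTq]
  · exact congrArg (· ⬝ T.adj) ((congrArg (· ⬝ g) hgT).trans hg.proj_mul_inv)
  · rw [adj_comp, adj_comp, adj_adj, hgs, comp_assoc]
  · rw [hgT]; exact hq.isSelfAdjoint

end AdjOp

end MoorePenrose

section SeparatedDecomposition

open scoped AdjOp

variable {𝔄 : Type*} [NonUnitalCStarAlgebra 𝔄] [PartialOrder 𝔄] [StarOrderedRing 𝔄]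
  {H : Type*} [NormedAddCommGroup H] [NormedSpace ℂ H] [SMul 𝔄 H] [CStarModule 𝔄 H]
  {K : Type*} [NormedAddCommGroup K] [NormedSpace ℂ K] [SMul 𝔄 K] [CStarModule 𝔄 K]
  {E : Type*} [NormedAddCommGroup E] [NormedSpace ℂ E] [SMul 𝔄 E] [CStarModule 𝔄 E]

namespace AdjOp

theorem isSeparatedPair_of_isProj {M N : Submodule ℂ H} {P Q : H →L[ℂ] H}
    (hP : LinearMap.IsProj M (P : H →ₗ[ℂ] H)) (hQ : LinearMap.IsProj N (Q : H →ₗ[ℂ] H))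
    (hQM : ∀ x ∈ M, Q x = 0) : IsSeparatedPair M N := by
  have hfix : ((M ⊔ N : Submodule ℂ H) : Set H) = {y | P y + Q y - P (Q y) = y} := by
    ext y
    constructor
    · intro hy
      obtain ⟨a, ha, b, hb, rfl⟩ := Submodule.mem_sup.1 hy
      have hPa : P a = a := hP.map_id a ha
      have hQb : Q b = b := hQ.map_id b hb
      change P (a + b) + Q (a + b) - P (Q (a + b)) = a + b
      rw [map_add, map_add, hPa, hQb, hQM a ha, zero_add]
      abel
    · intro hy
      rw [← show P y + Q y - P (Q y) = y from hy, add_sub_right_comm]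
      exact add_mem (Submodule.mem_sup_left (sub_mem (hP.map_mem _) (hP.map_mem _)))
        (Submodule.mem_sup_right (hQ.map_mem _))
  refine ⟨(Submodule.eq_bot_iff _).2 fun y ⟨hyM, hyN⟩ => ?_, ?_⟩
  · exact (hQ.map_id y hyN).symm.trans (hQM y hyM)
  · rw [hfix]
    exact isClosed_eq (by fun_prop) continuous_id

theorem isProj_adj_ran {T : AdjOp 𝔄 H K} {X : AdjOp 𝔄 K H} (h : T ⬝ X ⬝ T = T) :
    LinearMap.IsProj T.adj.ran ((X ⬝ T).adj.1 : H →ₗ[ℂ] H) where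
  map_mem x := by
    rw [adj_comp]
    exact ⟨X.adj.1 x, rfl⟩
  map_id := by
    rintro _ ⟨y, rfl⟩
    have hadj := congrArg adj h
    rw [adj_comp] at hadj
    exact congrArg (fun Z => Z.1 y) hadj

theorem isSeparatedPair_adj_ran {S : AdjOp 𝔄 H K} {T : AdjOp 𝔄 H E} {X : AdjOp 𝔄 K H}
    {Y : AdjOp 𝔄 E H} (hX : S ⬝ X ⬝ S = S) (hY : T ⬝ Y ⬝ T = T)
    (hXY : (X ⬝ S) ⬝ Y ⬝ T = 0) : IsSeparatedPair S.adj.ran T.adj.ran := by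
  have hzero : (Y ⬝ T).adj ⬝ (X ⬝ S).adj = 0 := by rw [← adj_comp, hXY, adj_zero]
  refine isSeparatedPair_of_isProj (isProj_adj_ran hX) (isProj_adj_ran hY) fun x hx => ?_
  rw [← (isProj_adj_ran hX).map_id x hx]
  exact congrArg (fun Z => Z.1 x) hzero

theorem adj_ran_le_iff {A : AdjOp 𝔄 H K} {X : AdjOp 𝔄 K H} (h : A ⬝ X ⬝ A = A)
    {C : AdjOp 𝔄 H E} : C.adj.ran ≤ A.adj.ran ↔ C ⬝ X ⬝ A = C := by
  have hiff : C ⬝ X ⬝ A = C ↔ (X ⬝ A).adj ⬝ C.adj = C.adj := by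
    rw [← adj_comp]
    exact (Function.LeftInverse.injective adj_adj).eq_iff.symm
  rw [hiff]
  constructor
  · exact fun hC => ext_apply fun y => (isProj_adj_ran h).map_id _ (hC ⟨y, rfl⟩)
  · rintro hC _ ⟨y, rfl⟩
    rw [← hC]
    exact (isProj_adj_ran h).map_mem _

/-- The projection onto the orthogonal complement of `R(A*)` in the closed submodule
`R(A*A + B*B)`, provided that both `A` and `A*A + B*B` are M-P invertible. -/
def complProj (A : AdjOp 𝔄 H K) (B : AdjOp 𝔄 H E) : AdjOp 𝔄 H H :=
  (A.adj ⬝ A + B.adj ⬝ B).mpInv ⬝ (A.adj ⬝ A + B.adj ⬝ B) - A.mpInv ⬝ A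

/-- The oblique projection `F = (R B*WB R)† B*WB` onto the range of `R = complProj A B`. The
components of the separated decomposition of `B` are `B - B F` and `B F`. -/
def obliqueProj (A : AdjOp 𝔄 H K) (B : AdjOp 𝔄 H E) (W : AdjOp 𝔄 E E) : AdjOp 𝔄 H H :=
  (complProj A B ⬝ (B.adj ⬝ W ⬝ B) ⬝ complProj A B).mpInv ⬝ B.adj ⬝ W ⬝ B

variable {A : AdjOp 𝔄 H K} {B : AdjOp 𝔄 H E} {W : AdjOp 𝔄 E E}

theorem comp_mpInv_adj_comp_self_add (hAB : (A.adj ⬝ A + B.adj ⬝ B).MPInvertible) :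
    A ⬝ (A.adj ⬝ A + B.adj ⬝ B).mpInv ⬝ (A.adj ⬝ A + B.adj ⬝ B) = A ∧
      B ⬝ (A.adj ⬝ A + B.adj ⬝ B).mpInv ⬝ (A.adj ⬝ A + B.adj ⬝ B) = B := by
  set D := A.adj ⬝ A + B.adj ⬝ B
  have hD : D ⬝ (idOp 𝔄 H - D.mpInv ⬝ D) = 0 := by
    rw [comp_sub, comp_idOp, hAB.isMPInverse_mpInv.mul_mul_self, sub_self]
  have hzero := comp_eq_zero_of_adj_comp_self_add_comp_eq_zero hD
  rwa [comp_sub, comp_sub, comp_idOp, comp_idOp, sub_eq_zero, sub_eq_zero, eq_comm,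
    eq_comm (a := B)] at hzero

theorem comp_complProj (hA : A.MPInvertible) (hAB : (A.adj ⬝ A + B.adj ⬝ B).MPInvertible) :
    A ⬝ complProj A B = 0 := by
  rw [complProj, comp_sub, (comp_mpInv_adj_comp_self_add hAB).1,
    hA.isMPInverse_mpInv.mul_mul_self, sub_self]

theorem comp_mpInv_comp_add_complProj (hAB : (A.adj ⬝ A + B.adj ⬝ B).MPInvertible) :
    B ⬝ (A.mpInv ⬝ A + complProj A B) = B := by
  rw [complProj, add_sub_cancel, (comp_mpInv_adj_comp_self_add hAB).2]

theorem isStarProjection_complProj (hA : A.MPInvertible)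
    (hAB : (A.adj ⬝ A + B.adj ⬝ B).MPInvertible) : IsStarProjection (complProj A B) :=
  hA.isMPInverse_mpInv.isStarProjection.sub_of_mul_eq_left hAB.isMPInverse_mpInv.isStarProjection
    (congrArg (A.mpInv ⬝ ·) (comp_mpInv_adj_comp_self_add hAB).1)

theorem leftInverse_comp_complProj (hA : A.MPInvertible)
    (hAB : (A.adj ⬝ A + B.adj ⬝ B).MPInvertible) :
    (complProj A B ⬝ (A.adj ⬝ A + B.adj ⬝ B).mpInv ⬝ B.adj) ⬝ (B ⬝ complProj A B) =
      complProj A B := by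
  set R := complProj A B
  set D := A.adj ⬝ A + B.adj ⬝ B with hD
  have hR : IsStarProjection R := isStarProjection_complProj hA hAB
  have hBR : (B.adj ⬝ B) ⬝ R = D ⬝ R := by
    have hAR : (A.adj ⬝ A) ⬝ R = 0 :=
      (congrArg (A.adj ⬝ ·) (comp_complProj hA hAB)).trans (comp_zero _)
    rw [hD, add_comp, hAR, zero_add]
  have hpR : D.mpInv ⬝ D = A.mpInv ⬝ A + R := (add_sub_cancel _ _).symm
  calc (R ⬝ D.mpInv ⬝ B.adj) ⬝ (B ⬝ R) = R ⬝ D.mpInv ⬝ (B.adj ⬝ B) ⬝ R := rfl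
    _ = R ⬝ (D.mpInv ⬝ D) ⬝ R := by rw [hBR]; rfl
    _ = R ⬝ A.mpInv ⬝ (A ⬝ R) + R ⬝ (R * R) := by rw [hpR, add_comp, comp_add]; rfl
    _ = R := by
      rw [comp_complProj hA hAB, comp_zero, comp_zero, zero_add, hR.isIdempotentElem.eq]
      exact hR.isIdempotentElem.eq

variable [CompleteSpace H] [CompleteSpace E]

theorem isCornerInverse_complProj (hA : A.MPInvertible)
    (hAB : (A.adj ⬝ A + B.adj ⬝ B).MPInvertible) (hW : W.PosDefinite) :
    IsCornerInverse (complProj A B) (complProj A B * (B.adj ⬝ W ⬝ B) * complProj A B)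
      (complProj A B ⬝ (B.adj ⬝ W ⬝ B) ⬝ complProj A B).mpInv := by
  have hR := isStarProjection_complProj hA hAB
  have hcorner := hW.isCornerInverse_mpInv (S := B ⬝ complProj A B) hR
    (leftInverse_comp_complProj hA hAB) (congrArg (B ⬝ ·) hR.isIdempotentElem.eq) le_rfl
    (zero_mul _)
  have hRs : (complProj A B).adj = complProj A B := hR.isSelfAdjoint
  rw [add_zero, adj_comp, hRs] at hcorner
  exact hcorner

theorem isObliqueProjection_obliqueProj (hA : A.MPInvertible)
    (hAB : (A.adj ⬝ A + B.adj ⬝ B).MPInvertible) (hW : W.PosDefinite) :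
    IsObliqueProjection (A.mpInv ⬝ A) (complProj A B) (obliqueProj A B W) :=
  (isCornerInverse_complProj hA hAB hW).isObliqueProjection
    hA.isMPInverse_mpInv.isStarProjection (isStarProjection_complProj hA hAB)
    ((congrArg (A.mpInv ⬝ ·) (comp_complProj hA hAB)).trans (comp_zero _))
    (congrArg (B.adj ⬝ W ⬝ ·) (comp_mpInv_comp_add_complProj hAB))

theorem adj_obliqueProj (hA : A.MPInvertible) (hAB : (A.adj ⬝ A + B.adj ⬝ B).MPInvertible)
    (hW : W.PosDefinite) : (obliqueProj A B W).adj =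
      B.adj ⬝ W ⬝ B ⬝ (complProj A B ⬝ (B.adj ⬝ W ⬝ B) ⬝ complProj A B).mpInv := by
  have hRs : (complProj A B).adj = complProj A B :=
    (isStarProjection_complProj hA hAB).isSelfAdjoint
  have hb : (B.adj ⬝ W ⬝ B).adj = B.adj ⬝ W ⬝ B := by
    rw [adj_comp, adj_comp, adj_adj, hW.selfAdjoint, comp_assoc]
  have hgs : (complProj A B ⬝ (B.adj ⬝ W ⬝ B) ⬝ complProj A B).mpInv.adj =
      (complProj A B ⬝ (B.adj ⬝ W ⬝ B) ⬝ complProj A B).mpInv := by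
    refine (isCornerInverse_complProj hA hAB hW).isSelfAdjoint hRs ?_
    change adj (complProj A B ⬝ (B.adj ⬝ W ⬝ B) ⬝ complProj A B) = _
    rw [adj_comp, adj_comp, hRs, hb]; rfl
  rw [obliqueProj, adj_comp, hb, hgs]; rfl

theorem comp_obliqueProj_comp_comp_self (hA : A.MPInvertible)
    (hAB : (A.adj ⬝ A + B.adj ⬝ B).MPInvertible) (hW : W.PosDefinite) :
    (B ⬝ obliqueProj A B W) ⬝
        ((complProj A B ⬝ (B.adj ⬝ W ⬝ B) ⬝ complProj A B).mpInv ⬝ B.adj ⬝ W) ⬝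
          (B ⬝ obliqueProj A B W) = B ⬝ obliqueProj A B W := by
  have hF := (isObliqueProjection_obliqueProj hA hAB hW).isIdempotentElem
  calc _ = B ⬝ (obliqueProj A B W * (obliqueProj A B W * obliqueProj A B W)) := rfl
    _ = _ := by rw [hF.eq, hF.eq]

theorem adj_ran_sub_comp_obliqueProj_le (hA : A.MPInvertible)
    (hAB : (A.adj ⬝ A + B.adj ⬝ B).MPInvertible) (hW : W.PosDefinite) {T : AdjOp 𝔄 H E}
    (hT : T ⬝ (A.mpInv ⬝ A + complProj A B) = T) :
    (T - T ⬝ obliqueProj A B W).adj.ran ≤ A.adj.ran := by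
  have hFP : obliqueProj A B W ⬝ A.mpInv ⬝ A = obliqueProj A B W - complProj A B :=
    eq_sub_of_add_eq (isObliqueProjection_obliqueProj hA hAB hW).mul_proj_add
  have hTP : T ⬝ A.mpInv ⬝ A = T - T ⬝ complProj A B := by
    rw [eq_sub_iff_add_eq, ← comp_add, hT]
  rw [adj_ran_le_iff hA.isMPInverse_mpInv.mul_mul_self, sub_comp, hTP, comp_assoc, hFP, comp_sub,
    sub_sub_sub_cancel_right]

theorem isSeparatedDecomposition_obliqueProj (hA : A.MPInvertible)
    (hAB : (A.adj ⬝ A + B.adj ⬝ B).MPInvertible) (hW : W.PosDefinite) :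
    IsSeparatedDecomposition A B W (B - B ⬝ obliqueProj A B W) (B ⬝ obliqueProj A B W) where
  eq_add := (sub_add_cancel _ _).symm
  orthogonal := by
    have hF := (isObliqueProjection_obliqueProj hA hAB hW).isIdempotentElem
    have hsymm : (B ⬝ obliqueProj A B W).adj ⬝ W ⬝ B = B.adj ⬝ W ⬝ B ⬝ obliqueProj A B W := by
      rw [adj_comp, adj_obliqueProj hA hAB hW]; rfl
    calc (B ⬝ obliqueProj A B W).adj ⬝ W ⬝ (B - B ⬝ obliqueProj A B W)
        = (B ⬝ obliqueProj A B W).adj ⬝ W ⬝ B -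
            ((B ⬝ obliqueProj A B W).adj ⬝ W ⬝ B) ⬝ obliqueProj A B W := by
          rw [comp_sub, comp_sub]; rfl
      _ = (B.adj ⬝ W ⬝ B) ⬝ obliqueProj A B W -
            (B.adj ⬝ W ⬝ B) ⬝ (obliqueProj A B W * obliqueProj A B W) := by rw [hsymm]; rfl
      _ = 0 := by rw [hF.eq, sub_self]
  range_le :=
    adj_ran_sub_comp_obliqueProj_le hA hAB hW (comp_mpInv_comp_add_complProj hAB)
  separated := by
    refine isSeparatedPair_adj_ran hA.isMPInverse_mpInv.mul_mul_self
      (comp_obliqueProj_comp_comp_self hA hAB hW) ?_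
    have h := isObliqueProjection_obliqueProj hA hAB hW
    calc _ = (A.mpInv ⬝ A) * (obliqueProj A B W * obliqueProj A B W) := rfl
      _ = 0 := by rw [h.isIdempotentElem.eq, h.proj_mul]

end AdjOp

open AdjOp

variable {A : AdjOp 𝔄 H K} {B B₁ B₂ : AdjOp 𝔄 H E} {W : AdjOp 𝔄 E E}

namespace IsSeparatedDecomposition

theorem comp_mpInv_comp (h : IsSeparatedDecomposition A B W B₁ B₂) (hA : A.MPInvertible) :
    B₁ ⬝ A.mpInv ⬝ A = B₁ :=
  (adj_ran_le_iff hA.isMPInverse_mpInv.mul_mul_self).1 h.range_le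

theorem comp_complProj (h : IsSeparatedDecomposition A B W B₁ B₂) (hA : A.MPInvertible)
    (hAB : (A.adj ⬝ A + B.adj ⬝ B).MPInvertible) : B₁ ⬝ complProj A B = 0 := by
  rw [← h.comp_mpInv_comp hA, comp_assoc, comp_assoc, AdjOp.comp_complProj hA hAB, comp_zero,
    comp_zero]

theorem adj_comp_comp_self (h : IsSeparatedDecomposition A B W B₁ B₂) (hW : W.adj = W) :
    B.adj ⬝ W ⬝ B = B₁.adj ⬝ W ⬝ B₁ + B₂.adj ⬝ W ⬝ B₂ := by
  have horth : B₁.adj ⬝ W ⬝ B₂ = 0 := by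
    have hadj := congrArg adj h.orthogonal
    rwa [adj_comp, adj_comp, adj_adj, hW, adj_zero, comp_assoc] at hadj
  rw [h.eq_add, adj_add, add_comp, comp_add, comp_add, comp_add, h.orthogonal, horth,
    add_zero, zero_add]

variable [CompleteSpace H] [CompleteSpace E]

theorem obliqueProj_eq (h : IsSeparatedDecomposition A B W B₁ B₂) (hA : A.MPInvertible)
    (hAB : (A.adj ⬝ A + B.adj ⬝ B).MPInvertible) (hW : W.PosDefinite) :
    obliqueProj A B W =
      ((complProj A B ⬝ (B.adj ⬝ W ⬝ B) ⬝ complProj A B).mpInv ⬝ B₂.adj ⬝ W) ⬝ B₂ := by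
  have hG := isCornerInverse_complProj hA hAB hW
  set G := (complProj A B ⬝ (B.adj ⬝ W ⬝ B) ⬝ complProj A B).mpInv
  have hRs : (complProj A B).adj = complProj A B :=
    (isStarProjection_complProj hA hAB).isSelfAdjoint
  have hGB₁ : G ⬝ B₁.adj = 0 := by
    calc G ⬝ B₁.adj = (G * complProj A B) ⬝ B₁.adj := by rw [hG.inv_mul_proj]
      _ = G ⬝ (B₁ ⬝ complProj A B).adj := by rw [adj_comp, hRs]; rfl
      _ = 0 := by rw [h.comp_complProj hA hAB, adj_zero, comp_zero]
  calc obliqueProj A B W = G ⬝ (B.adj ⬝ W ⬝ B) := rfl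
    _ = (G ⬝ B₁.adj) ⬝ W ⬝ B₁ + G ⬝ B₂.adj ⬝ W ⬝ B₂ := by
      rw [h.adj_comp_comp_self hW.selfAdjoint, comp_add]; rfl
    _ = (G ⬝ B₂.adj ⬝ W) ⬝ B₂ := by rw [hGB₁, zero_comp, zero_add]; rfl

theorem comp_obliqueProj (h : IsSeparatedDecomposition A B W B₁ B₂) (hA : A.MPInvertible)
    (hAB : (A.adj ⬝ A + B.adj ⬝ B).MPInvertible) (hW : W.PosDefinite) :
    B ⬝ obliqueProj A B W = B₂ ⬝ obliqueProj A B W := by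
  have hRF : complProj A B ⬝ obliqueProj A B W = obliqueProj A B W :=
    (isObliqueProjection_obliqueProj hA hAB hW).range_mul
  have hB₁F : B₁ ⬝ obliqueProj A B W = 0 := by
    rw [← hRF, ← comp_assoc, h.comp_complProj hA hAB, zero_comp]
  nth_rw 1 [h.eq_add]
  rw [add_comp, hB₁F, zero_add]

theorem eq_comp_obliqueProj (h : IsSeparatedDecomposition A B W B₁ B₂) (hA : A.MPInvertible)
    (hAB : (A.adj ⬝ A + B.adj ⬝ B).MPInvertible) (hW : W.PosDefinite) :
    B₂ = B ⬝ obliqueProj A B W := by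
  have hB₂ : B₂ ⬝ (A.mpInv ⬝ A + complProj A B) = B₂ := by
    have hB := comp_mpInv_comp_add_complProj hAB
    rw [eq_sub_of_add_eq' h.eq_add.symm, sub_comp, hB, comp_add, h.comp_mpInv_comp hA,
      h.comp_complProj hA hAB, add_zero]
  have hCA := adj_ran_sub_comp_obliqueProj_le hA hAB hW hB₂
  set C := B₂ - B₂ ⬝ obliqueProj A B W with hC
  have hCB₂ : C.adj.ran ≤ B₂.adj.ran := by
    rw [hC, h.obliqueProj_eq hA hAB hW, adj_sub, adj_comp B₂, adj_comp _ B₂]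
    rintro _ ⟨y, rfl⟩
    exact sub_mem ⟨y, rfl⟩ ⟨_, rfl⟩
  have hCzero : C.adj = 0 := ext_apply fun y => by
    have hy : C.adj.1 y ∈ A.adj.ran ⊓ B₂.adj.ran := ⟨hCA ⟨y, rfl⟩, hCB₂ ⟨y, rfl⟩⟩
    rwa [h.separated.1, Submodule.mem_bot] at hy
  rw [h.comp_obliqueProj hA hAB hW, ← sub_eq_zero, ← hC, ← adj_adj C, hCzero, adj_zero]

end IsSeparatedDecomposition

theorem existsUnique_isSeparatedDecomposition [CompleteSpace H] [CompleteSpace E]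
    (hA : A.MPInvertible) (hAB : (A.adj ⬝ A + B.adj ⬝ B).MPInvertible) (hW : W.PosDefinite) :
    ∃! p : AdjOp 𝔄 H E × AdjOp 𝔄 H E, IsSeparatedDecomposition A B W p.1 p.2 := by
  refine ⟨(B - B ⬝ obliqueProj A B W, B ⬝ obliqueProj A B W),
    isSeparatedDecomposition_obliqueProj hA hAB hW, fun p hp => ?_⟩
  have hp₂ := hp.eq_comp_obliqueProj hA hAB hW
  exact Prod.ext (by rw [← hp₂]; exact eq_sub_of_add_eq hp.eq_add.symm) hp₂

end SeparatedDecomposition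

section Limit

open AdjOp
open scoped AdjOp

variable {𝔄 : Type*} [NonUnitalCStarAlgebra 𝔄] [PartialOrder 𝔄] [StarOrderedRing 𝔄]
  {H : Type*} [NormedAddCommGroup H] [NormedSpace ℂ H] [SMul 𝔄 H] [CStarModule 𝔄 H]
  {K : Type*} [NormedAddCommGroup K] [NormedSpace ℂ K] [SMul 𝔄 K] [CStarModule 𝔄 K]
  {E : Type*} [NormedAddCommGroup E] [NormedSpace ℂ E] [SMul 𝔄 E] [CStarModule 𝔄 E]
  {A : AdjOp 𝔄 H K} {B B₁ B₂ : AdjOp 𝔄 H E} {V : AdjOp 𝔄 K K}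
  {W W' : AdjOp 𝔄 E E}

theorem AdjOp.two_smul_idOp_sub_sub (P Q : AdjOp 𝔄 H H) :
    (2 : ℂ) • idOp 𝔄 H - P - Q = (1 - P) + (1 - Q) := by
  change (2 : ℂ) • (1 : AdjOp 𝔄 H H) - P - Q = _
  rw [two_smul]; abel

variable [CompleteSpace H] [CompleteSpace E]

theorem AdjOp.PosDefinite.isCornerInverse_adj_comp_comp [CompleteSpace K] (hV : V.PosDefinite)
    (hA : A.MPInvertible) :
    IsCornerInverse (A.mpInv ⬝ A) (A.adj ⬝ V ⬝ A) (A.adj ⬝ V ⬝ A).mpInv := by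
  have h := hV.isCornerInverse_mpInv hA.isMPInverse_mpInv.isStarProjection rfl
    hA.isMPInverse_mpInv.mul_mul_self le_rfl (zero_mul _)
  rwa [add_zero] at h

namespace IsSeparatedDecomposition

theorem mpInvertible_and_mpInv_comp_adj (h : IsSeparatedDecomposition A B W B₁ B₂)
    (hA : A.MPInvertible) (hAB : (A.adj ⬝ A + B.adj ⬝ B).MPInvertible) (hW : W.PosDefinite)
    (hW' : W'.PosDefinite) {m x : AdjOp 𝔄 H H} (hm : IsCornerInverse (A.mpInv ⬝ A) m x) :
    (m + B₂.adj ⬝ W' ⬝ B₂).MPInvertible ∧ (m + B₂.adj ⬝ W' ⬝ B₂).mpInv ⬝ A.adj =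
      (idOp 𝔄 H - obliqueProj A B W) ⬝ x ⬝ A.adj := by
  obtain ⟨y, hy, hyP⟩ := (isObliqueProjection_obliqueProj hA hAB hW).exists_isCornerInverse_add hm
    (isCornerInverse_complProj hA hAB hW')
  have hproj : (A.mpInv ⬝ A + complProj A B).adj = A.mpInv ⬝ A + complProj A B := by
    rw [adj_add, hA.isMPInverse_mpInv.adj_right]
    exact congrArg (_ + ·) (isStarProjection_complProj hA hAB).isSelfAdjoint
  have hyM : (m + B₂.adj ⬝ W' ⬝ B₂).IsMPInverse y := by
    rw [h.eq_comp_obliqueProj hA hAB hW, adj_comp]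
    exact hy.isMPInverse hproj
  refine ⟨⟨y, hyM⟩, ?_⟩
  calc (m + B₂.adj ⬝ W' ⬝ B₂).mpInv ⬝ A.adj = (y * (A.mpInv ⬝ A)) ⬝ A.adj := by
        nth_rw 1 [hyM.mpInv_eq, ← hA.isMPInverse_mpInv.comp_comp_adj]; rfl
    _ = (idOp 𝔄 H - obliqueProj A B W) ⬝ x ⬝ A.adj := by rw [hyP]; rfl

section Perturbation

variable [CompleteSpace K] (h : IsSeparatedDecomposition A B W B₁ B₂)
  (hA : A.MPInvertible) (hAB : (A.adj ⬝ A + B.adj ⬝ B).MPInvertible) (hV : V.PosDefinite)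
  (hW : W.PosDefinite)

include h hA hV hW

theorem isCornerInverse_add_smul {t : ℝ} (ht : 0 < t) :
    IsCornerInverse (A.mpInv ⬝ A) (A.adj ⬝ V ⬝ A + (t : ℂ) • (B₁.adj ⬝ W ⬝ B₁))
      (A.adj ⬝ V ⬝ A + (t : ℂ) • (B₁.adj ⬝ W ⬝ B₁)).mpInv := by
  refine hV.isCornerInverse_mpInv hA.isMPInverse_mpInv.isStarProjection rfl
    hA.isMPInverse_mpInv.mul_mul_self ?_ ?_
  · rw [← comp_smul, ← smul_comp]
    exact conj_nonneg (hW.smul ht).nonneg B₁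
  · rw [smul_mul_assoc]
    exact congrArg ((t : ℂ) • B₁.adj ⬝ W ⬝ ·) (h.comp_mpInv_comp hA)

theorem tendsto_mpInv_add_smul :
    Tendsto (fun t : ℝ => (A.adj ⬝ V ⬝ A + (t : ℂ) • (B₁.adj ⬝ W ⬝ B₁)).mpInv) (𝓝[>] 0)
      (𝓝 (A.adj ⬝ V ⬝ A).mpInv) := by
  have hcont : Continuous fun t : ℝ => A.adj ⬝ V ⬝ A + (t : ℂ) • (B₁.adj ⬝ W ⬝ B₁) := by fun_prop
  have hlim := (hcont.tendsto 0).mono_left (nhdsWithin_le_nhds (s := Set.Ioi 0))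
  rw [Complex.ofReal_zero, zero_smul, add_zero] at hlim
  exact (hV.isCornerInverse_adj_comp_comp hA).tendsto hlim
    (eventually_mem_nhdsWithin.mono fun t ht => h.isCornerInverse_add_smul hA hV hW ht)

include hAB

theorem mpInvertible_and_mpInv_comp_adj_of_pos {t : ℝ} (ht : 0 < t) :
    (A.adj ⬝ V ⬝ A + (t : ℂ) • (B.adj ⬝ W ⬝ B)).MPInvertible ∧
      (A.adj ⬝ V ⬝ A + (t : ℂ) • (B.adj ⬝ W ⬝ B)).mpInv ⬝ A.adj =
        (idOp 𝔄 H - obliqueProj A B W) ⬝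
          (A.adj ⬝ V ⬝ A + (t : ℂ) • (B₁.adj ⬝ W ⬝ B₁)).mpInv ⬝ A.adj := by
  have hsum := h.mpInvertible_and_mpInv_comp_adj hA hAB hW (hW.smul ht)
    (h.isCornerInverse_add_smul hA hV hW ht)
  rwa [smul_comp, comp_smul, add_assoc, ← smul_add, ← h.adj_comp_comp_self hW.selfAdjoint] at hsum

theorem tendsto_mpInv_comp_adj_comp (hW' : W'.PosDefinite) :
    Tendsto (fun t : ℝ => (A.adj ⬝ V ⬝ A + (t : ℂ) • (B.adj ⬝ W ⬝ B)).mpInv ⬝ A.adj ⬝ V) (𝓝[>] 0)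
      (𝓝 ((A.adj ⬝ V ⬝ A + B₂.adj ⬝ W' ⬝ B₂).mpInv ⬝ A.adj ⬝ V)) := by
  have hlim := ((continuous_comp_left (A.adj ⬝ V)).tendsto _).comp
    ((h.tendsto_mpInv_add_smul hA hV hW).const_mul (idOp 𝔄 H - obliqueProj A B W))
  have hval : ((idOp 𝔄 H - obliqueProj A B W) * (A.adj ⬝ V ⬝ A).mpInv) ⬝ A.adj ⬝ V =
      (A.adj ⬝ V ⬝ A + B₂.adj ⬝ W' ⬝ B₂).mpInv ⬝ A.adj ⬝ V :=
    congrArg (· ⬝ V) (h.mpInvertible_and_mpInv_comp_adj hA hAB hW hW'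
      (hV.isCornerInverse_adj_comp_comp hA)).2.symm
  rw [hval] at hlim
  refine hlim.congr' (eventually_mem_nhdsWithin.mono fun t ht => ?_)
  exact congrArg (· ⬝ V) (h.mpInvertible_and_mpInv_comp_adj_of_pos hA hAB hV hW ht).2.symm

end Perturbation

section ClosedForm

variable (h : IsSeparatedDecomposition A B W B₁ B₂) (hA : A.MPInvertible)
  (hAB : (A.adj ⬝ A + B.adj ⬝ B).MPInvertible) (hW : W.PosDefinite)

include h hA hAB hW

theorem mpInvertible_right : B₂.MPInvertible := by
  rw [h.eq_comp_obliqueProj hA hAB hW]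
  exact mpInvertible_of_comp_comp_self (comp_obliqueProj_comp_comp_self hA hAB hW)

theorem obliqueProj_mul_mpInv_comp :
    obliqueProj A B W * (B₂.mpInv ⬝ B₂) = obliqueProj A B W := by
  have hB₂ := (h.mpInvertible_right hA hAB hW).isMPInverse_mpInv.mul_mul_self
  have hF := h.obliqueProj_eq hA hAB hW
  set Z := (complProj A B ⬝ (B.adj ⬝ W ⬝ B) ⬝ complProj A B).mpInv ⬝ B₂.adj ⬝ W
  rw [hF]
  exact congrArg (Z ⬝ ·) hB₂

theorem mpInv_comp_mul_obliqueProj :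
    B₂.mpInv ⬝ B₂ * obliqueProj A B W = B₂.mpInv ⬝ B₂ :=
  congrArg (B₂.mpInv ⬝ ·)
    ((h.comp_obliqueProj hA hAB hW).symm.trans (h.eq_comp_obliqueProj hA hAB hW).symm)

theorem invertible_two_smul_sub_sub :
    ((2 : ℂ) • idOp 𝔄 H - A.mpInv ⬝ A - B₂.mpInv ⬝ B₂).Invertible := by
  rw [invertible_iff_isUnit, two_smul_idOp_sub_sub]
  exact isUnit_one_sub_add_one_sub hA.isMPInverse_mpInv.isStarProjection
    (h.mpInvertible_right hA hAB hW).isMPInverse_mpInv.isStarProjection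
    (isObliqueProjection_obliqueProj hA hAB hW).proj_mul (h.mpInv_comp_mul_obliqueProj hA hAB hW)

theorem obliqueProj_mul_mpInv_comp_self :
    obliqueProj A B W * (A.mpInv ⬝ A) = (idOp 𝔄 H - A.mpInv ⬝ A) *
      ((2 : ℂ) • idOp 𝔄 H - A.mpInv ⬝ A - B₂.mpInv ⬝ B₂).inverse * (A.mpInv ⬝ A) := by
  obtain ⟨hleft, hright⟩ := (h.invertible_two_smul_sub_sub hA hAB hW).isInverse_inverse
  rw [two_smul_idOp_sub_sub] at hleft hright ⊢
  exact ((isObliqueProjection_obliqueProj hA hAB hW).one_sub_mul_mul_proj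
    (h.mpInvertible_right hA hAB hW).isMPInverse_mpInv.adj_right
    (h.obliqueProj_mul_mpInv_comp hA hAB hW) (h.mpInv_comp_mul_obliqueProj hA hAB hW)
    hright hleft).symm

theorem mpInv_comp_adj_comp_eq [CompleteSpace K] (hV : V.PosDefinite) (hW' : W'.PosDefinite) :
    (A.adj ⬝ V ⬝ A + B₂.adj ⬝ W' ⬝ B₂).mpInv ⬝ A.adj ⬝ V =
      (A.adj ⬝ V ⬝ A).mpInv ⬝ A.adj ⬝ V - (idOp 𝔄 H - A.mpInv ⬝ A) ⬝
        (((2 : ℂ) • idOp 𝔄 H - A.mpInv ⬝ A - B₂.mpInv ⬝ B₂).inverse ⬝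
          (A.adj ⬝ V ⬝ A).mpInv ⬝ A.adj ⬝ V) := by
  have hx := hV.isCornerInverse_adj_comp_comp hA
  have hlimit := (h.mpInvertible_and_mpInv_comp_adj hA hAB hW hW' hx).2
  have hFP := h.obliqueProj_mul_mpInv_comp_self hA hAB hW
  set F := obliqueProj A B W
  set P := A.mpInv ⬝ A
  set x := (A.adj ⬝ V ⬝ A).mpInv
  set s := ((2 : ℂ) • idOp 𝔄 H - P - B₂.mpInv ⬝ B₂).inverse
  have hFx : F * x = (idOp 𝔄 H - P) * s * x := by
    rw [← hx.proj_mul_inv, ← mul_assoc, hFP, mul_assoc]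
  calc (A.adj ⬝ V ⬝ A + B₂.adj ⬝ W' ⬝ B₂).mpInv ⬝ A.adj ⬝ V
      = (x - F * x) ⬝ A.adj ⬝ V := congrArg (· ⬝ V) hlimit
    _ = x ⬝ A.adj ⬝ V - (idOp 𝔄 H - P) ⬝ (s ⬝ x ⬝ A.adj ⬝ V) := by rw [hFx]; rfl

end ClosedForm

end IsSeparatedDecomposition

end Limit

end HilbertModuleLimits

theorem mainTheorem10
    {𝔄 : Type*} [NonUnitalCStarAlgebra 𝔄] [PartialOrder 𝔄] [StarOrderedRing 𝔄]
    {H : Type*} [NormedAddCommGroup H] [NormedSpace ℂ H] [SMul 𝔄 H] [CStarModule 𝔄 H]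
    [CompleteSpace H]
    {K : Type*} [NormedAddCommGroup K] [NormedSpace ℂ K] [SMul 𝔄 K] [CStarModule 𝔄 K]
    [CompleteSpace K]
    {E : Type*} [NormedAddCommGroup E] [NormedSpace ℂ E] [SMul 𝔄 E] [CStarModule 𝔄 E]
    [CompleteSpace E]
    (A : AdjOp 𝔄 H K) (B : AdjOp 𝔄 H E)
    (hA : A.MPInvertible) (hAB : (A.adj ⬝ A + B.adj ⬝ B).MPInvertible)
    (V : AdjOp 𝔄 K K) (hV : V.PosDefinite) (W : AdjOp 𝔄 E E) (hW : W.PosDefinite) :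
    -- the decomposition exists and is unique
    (∃! p : AdjOp 𝔄 H E × AdjOp 𝔄 H E, IsSeparatedDecomposition A B W p.1 p.2) ∧
    ∀ B₁ B₂ : AdjOp 𝔄 H E, IsSeparatedDecomposition A B W B₁ B₂ →
    ∀ W' : AdjOp 𝔄 E E, W'.PosDefinite →
      -- every inverse in the formulas is a genuine one
      (∀ t : ℝ, 0 < t →
        (A.adj ⬝ V ⬝ A + (t : ℂ) • (B.adj ⬝ W ⬝ B)).MPInvertible) ∧
      (A.adj ⬝ V ⬝ A + B₂.adj ⬝ W' ⬝ B₂).MPInvertible ∧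
      (A.adj ⬝ V ⬝ A).MPInvertible ∧
      B₂.MPInvertible ∧
      ((2 : ℂ) • AdjOp.idOp 𝔄 H - A.mpInv ⬝ A - B₂.mpInv ⬝ B₂).Invertible ∧
      -- the limit formula, in the operator norm
      Tendsto
        (fun t : ℝ => (A.adj ⬝ V ⬝ A + (t : ℂ) • (B.adj ⬝ W ⬝ B)).mpInv ⬝ A.adj ⬝ V)
        (𝓝[>] 0)
        (𝓝 ((A.adj ⬝ V ⬝ A + B₂.adj ⬝ W' ⬝ B₂).mpInv ⬝ A.adj ⬝ V)) ∧
      -- the closed form of the limit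
      (A.adj ⬝ V ⬝ A + B₂.adj ⬝ W' ⬝ B₂).mpInv ⬝ A.adj ⬝ V =
        (A.adj ⬝ V ⬝ A).mpInv ⬝ A.adj ⬝ V -
          (AdjOp.idOp 𝔄 H - A.mpInv ⬝ A) ⬝
            (((2 : ℂ) • AdjOp.idOp 𝔄 H - A.mpInv ⬝ A - B₂.mpInv ⬝ B₂).inverse ⬝
              (A.adj ⬝ V ⬝ A).mpInv ⬝ A.adj ⬝ V) := by
  refine ⟨existsUnique_isSeparatedDecomposition hA hAB hW, fun B₁ B₂ h W' hW' => ?_⟩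
  have hcorner := hV.isCornerInverse_adj_comp_comp hA
  exact ⟨fun t ht => (h.mpInvertible_and_mpInv_comp_adj_of_pos hA hAB hV hW ht).1,
    (h.mpInvertible_and_mpInv_comp_adj hA hAB hW hW' hcorner).1,
    ⟨_, hcorner.isMPInverse hA.isMPInverse_mpInv.adj_right⟩,
    h.mpInvertible_right hA hAB hW,
    h.invertible_two_smul_sub_sub hA hAB hW,
    h.tendsto_mpInv_comp_adj_comp hA hAB hV hW hW',
    h.mpInv_comp_adj_comp_eq hA hAB hW hV hW'⟩
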